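/- Let $0<p<1$, $q=1-p$, $P_i=pq^{i-1}$ for $i\ge 1$, and let $Z_1,Z_2,\dots$ be independent random variables with $\mathbb P(Z_k=i)=P_i$ for $i\ge1$. Let $X_1^{(n)}$ be the number of $i\ge 1$ such that $Z_k=Z_{k+1}=i$ for some $1\le k\le n-1$. For each $n$ let $\xi^{(n)}_i$, $i\ge1$, be independent random variables, $\xi_i^{(n)}$ Poisson distributed with parameter $nP_i^2$, and let $\xi^{(n)}$ be the number of $i\ge1$ with $\xi_i^{(n)}\ge 1$. Put $L=\ln(1/q)$, $i^*=i^*(n)=\ln(np^2/q^2)/(2L)$, $\alpha=q^2/(1-q^2)$ and $$\Psi(\eta)=e^{-e^{-2L\eta}}\prod_{i=1}^\infty\left(1-e^{-e^{-2L(\eta-i)}}\right),$$ $$f(\eta)=\sum_{v=0}^\infty \Psi(\eta-v+1)\,e^{-\alpha e^{-2L(\eta+1-v)}}\sum_{\substack{r_1<\cdots<r_v\\ r_j\ge 2-v}}\ \prod_{j=1}^v\frac{1-e^{-e^{-2L(\eta+r_j)}}}{e^{-e^{-2L(\eta+r_j)}}},\qquad F(\eta)=\sum_{i=0}^\infty f(\eta-i),$$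 where the inner sum is over integer tuples (and equals $1$ for $v=0$). Assume the conjecture that for every $t\in\mathbb R$ $$\lim_{n\to\infty}\left[\mathbb P(X_1^{(n)}\le t)-\mathbb P(\xi^{(n)}\le t)\right]=0 .$$ Then the product and all sums above converge for every real $\eta$, so that $f$ and $F$ are well-defined functions that depend only on $p$ and $\eta$, and, as $n\to\infty$, with $\eta=i-i^*(n)$ for integers $i$, $$\mathbb P(X_1^{(n)}=i^*+\eta)\sim f(\eta),\qquad \mathbb P(X_1^{(n)}\le i^*+\eta)\sim F(\eta),$$ in the following sense. Both differences $\mathbb P(X_1^{(n)}=i)-f(i-i^*(n))$ and $\mathbb P(X_1^{(n)}\le i)-F(i-i^*(n))$ tend to $0$ uniformly in $i\in\mathbb Z$; and for every sequence of integers $i_n$ for which $i_n-i^*(n)$ is bounded, the quotients $\mathbb P(X_1^{(n)}=i_n)/f(i_n-i^*(n))$ and $\mathbb P(X_1^{(n)}\le i_n)/F(i_n-i^*(n))$ tend to $1$. -/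

import Mathlib

open MeasureTheory ProbabilityTheory Filter Topology Asymptotics

noncomputable section

namespace GeomPairs

/-- `P_i = p q^(i-1)` with `q = 1 - p`: the probability of the letter `i ≥ 1`. -/
def letterProb (p : ℝ) (i : ℕ) : ℝ := p * (1 - p) ^ (i - 1)

/-- `Z` is a sequence of independent geometric letters: `ℙ(Z k = i) = P_i` for `i ≥ 1`.
The string of size `n` consists of the letters `Z 0, …, Z (n - 1)`. -/
structure IsGeometricSequence {Ω : Type*} [MeasurableSpace Ω] (μ : Measure Ω) (p : ℝ)
    (Z : ℕ → Ω → ℕ) : Prop where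
  measurable : ∀ k, Measurable (Z k)
  indep : iIndepFun Z μ
  law : ∀ k, ∀ i : ℕ, 1 ≤ i → μ.real {ω | Z k ω = i} = letterProb p i

open Classical in
/-- The indicator that the pair `(i, j)` appears (consecutively) at least once in the string of
size `n`. -/
def pairIndicator {Ω : Type*} (Z : ℕ → Ω → ℕ) (n i j : ℕ) (ω : Ω) : ℕ :=
  if ∃ k : ℕ, k + 1 < n ∧ Z k ω = i ∧ Z (k + 1) ω = j then 1 else 0

/-- The number of types of identical consecutive pairs in the string of size `n`: the sum over
`i ≥ 1` of the indicators of the pairs `(i, i)` (only finitely many of them are nonzero). -/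
def X₁ {Ω : Type*} (Z : ℕ → Ω → ℕ) (n : ℕ) (ω : Ω) : ℕ :=
  ∑' i : ℕ+, pairIndicator Z n i i ω

/-- For every `n`, the variables `ξ n i`, `i ≥ 1`, are independent, and `ξ n i` is Poisson
distributed with parameter `n P_i ^ 2`. -/
structure IsPoissonModel {Ω : Type*} [MeasurableSpace Ω] (ν : Measure Ω) (p : ℝ)
    (ξ : ℕ → ℕ+ → Ω → ℕ) : Prop where
  measurable : ∀ n i, Measurable (ξ n i)
  indep : ∀ n, iIndepFun (ξ n) ν
  law : ∀ n (i : ℕ+), ν.map (ξ n i) = poissonMeasure (Real.toNNReal (n * letterProb p i ^ 2))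

/-- The number of indices `i ≥ 1` with `ξ n i ≥ 1` (with values in `[0, ∞]`; it is almost surely
finite in the Poisson model). -/
def xiCount {Ω : Type*} (ξ : ℕ → ℕ+ → Ω → ℕ) (n : ℕ) (ω : Ω) : ENNReal :=
  ∑' i : ℕ+, if 1 ≤ ξ n i ω then 1 else 0

/-- For every real `t`, `ℙ(X₁ ≤ t) - ℙ(ξ ≤ t) → 0` as `n → ∞`. -/
def DistributionsMerge {Ω Ω' : Type*} [MeasurableSpace Ω] [MeasurableSpace Ω']
    (μ : Measure Ω) (ν : Measure Ω') (Z : ℕ → Ω → ℕ) (ξ : ℕ → ℕ+ → Ω' → ℕ) : Prop :=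
  ∀ t : ℝ, Tendsto
    (fun n : ℕ => μ.real {ω | (X₁ Z n ω : ℝ) ≤ t} -
      ν.real {ω | (xiCount ξ n ω : EReal) ≤ (t : EReal)})
    atTop (𝓝 0)

/-- `L = ln (1 / q)`. -/
def L (p : ℝ) : ℝ := Real.log (1 / (1 - p))

/-- `i* = ln (n p² / q²) / (2 L)`. -/
def iStar (p : ℝ) (n : ℕ) : ℝ := Real.log (n * p ^ 2 / (1 - p) ^ 2) / (2 * L p)

/-- `α = q² / (1 - q²)`. -/
def α (p : ℝ) : ℝ := (1 - p) ^ 2 / (1 - (1 - p) ^ 2)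

/-- The double exponential `exp (- exp (- 2 L x))`. -/
def dexp (p x : ℝ) : ℝ := Real.exp (-Real.exp (-2 * L p * x))

/-- `Ψ(η) = e^(-e^(-2Lη)) ∏_{i ≥ 1} (1 - e^(-e^(-2L(η-i))))`. -/
def Ψ (p η : ℝ) : ℝ := dexp p η * ∏' i : ℕ+, (1 - dexp p (η - (i : ℕ)))

/-- Integer tuples `r_1 < ⋯ < r_v` with all `r_j ≥ 2 - v`. -/
def Tuples (v : ℕ) : Type := {r : Fin v → ℤ // StrictMono r ∧ ∀ j, 2 - (v : ℤ) ≤ r j}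

/-- `∏_{j=1}^v (1 - e^(-e^(-2L(η+r_j)))) / e^(-e^(-2L(η+r_j)))`. -/
def tupleWeight (p η : ℝ) (v : ℕ) (r : Tuples v) : ℝ :=
  ∏ j : Fin v, (1 - dexp p (η + (r.1 j : ℝ))) / dexp p (η + (r.1 j : ℝ))

/-- The `v`-th term of the series defining `f`. -/
def fTerm (p η : ℝ) (v : ℕ) : ℝ :=
  Ψ p (η - v + 1) * Real.exp (-α p * Real.exp (-2 * L p * (η + 1 - v))) *
    ∑' r : Tuples v, tupleWeight p η v r

/-- The asymptotic probability function; it depends on `p` and `η` only. -/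
def f (p η : ℝ) : ℝ := ∑' v : ℕ, fTerm p η v

/-- The asymptotic distribution function `F(η) = ∑_{i ≥ 0} f(η - i)`. -/
def F (p η : ℝ) : ℝ := ∑' i : ℕ, f p (η - i)

end GeomPairs

end

/-! ### Double exponentials: tail bounds and convergent products. -/

namespace GeomPairs

/-! Since `n P_i² = e^{-2L(i - i*)}`, letter `i` should have no repeated pair with probability about
`dexp p (i - i*)`, almost independently over `i`. The set of letters with a pair should therefore
look like independent bits indexed by `ℤ` (`model` with `y = -i*`), which almost surely are true far
to the left and false far to the right. `X₁` then corresponds to `total`, in which an all-true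
half-line up to `a` counts as `a`.

In the model the formulas are exact. If `total = m` and the first false bit is at `m - v + 1`, then
exactly `v` true bits lie above it, at places `m + r_j` with `r_j ≥ 2 - v`. The first false bit and
the true bits below it contribute `Ψ`; the exponential factor is the probability that all later bits
are false; the tuple weight corrects it at the `v` true places. So `f` is the probability function
of `total` (`f_add_eq`) and `F` its distribution function (`F_add_eq`), and the series converge
because they add up probabilities of disjoint events.

The string is compared with the model on a window of fixed width around `i*`. Outside it, geometric
tail bounds apply to both sides. Inside it, the letter probabilities tend to `0` with `n`; a
recurrence yields the avoidance probabilities (`abs_real_avoid_sub_le`), and inclusion-exclusion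
transfers this to all patterns at a cost depending only on the width
(`abs_real_pattern_mem_sub_le`). The result is closeness in total variation, uniformly over events.
The quotients follow because `f` is bounded below on bounded sets. -/

theorem L_pos {p : ℝ} (hp₀ : 0 < p) (hp₁ : p < 1) : 0 < L p := by
  have h : (1 : ℝ) < 1 / (1 - p) := by
    rw [lt_div_iff₀ (by linarith)]; linarith
  exact Real.log_pos h

theorem exp_neg_two_L {p : ℝ} (hp₁ : p < 1) : Real.exp (-2 * L p) = (1 - p) ^ 2 := by
  have hq : 0 < 1 - p := by linarith
  rw [L, one_div, Real.log_inv, show -2 * -Real.log (1 - p) = (2 : ℕ) * Real.log (1 - p) by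
    push_cast; ring, Real.exp_nat_mul, Real.exp_log hq]

theorem ratio_lt_one {p : ℝ} (hp₀ : 0 < p) (hp₁ : p < 1) : (1 - p) ^ 2 < 1 := by nlinarith

theorem exp_shift {p : ℝ} (hp₁ : p < 1) (x : ℝ) (k : ℕ) :
    Real.exp (-2 * L p * (x + k)) = Real.exp (-2 * L p * x) * ((1 - p) ^ 2) ^ k := by
  rw [← exp_neg_two_L hp₁, ← Real.exp_nat_mul, ← Real.exp_add]
  congr 1; ring

theorem hasSum_exp_tail {p : ℝ} (hp₀ : 0 < p) (hp₁ : p < 1) (x : ℝ) :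
    HasSum (fun k : ℕ => Real.exp (-2 * L p * (x + k)))
      (Real.exp (-2 * L p * x) * (1 - (1 - p) ^ 2)⁻¹) := by
  simp_rw [exp_shift hp₁]
  exact (hasSum_geometric_of_lt_one (by positivity) (ratio_lt_one hp₀ hp₁)).mul_left _

theorem dexp_pos (p x : ℝ) : 0 < dexp p x := Real.exp_pos _

theorem dexp_lt_one (p x : ℝ) : dexp p x < 1 :=
  Real.exp_lt_one_iff.2 (by simpa using Real.exp_pos _)

theorem dexp_mono {p : ℝ} (hp₀ : 0 < p) (hp₁ : p < 1) : Monotone (dexp p) := by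
  intro x y hxy
  have := L_pos hp₀ hp₁
  apply Real.exp_le_exp.2
  apply neg_le_neg
  apply Real.exp_le_exp.2
  nlinarith

theorem one_sub_dexp_le (p x : ℝ) : 1 - dexp p x ≤ Real.exp (-2 * L p * x) := by
  have := Real.add_one_le_exp (-Real.exp (-2 * L p * x))
  unfold dexp
  linarith

theorem exp_neg_le_inv {y : ℝ} (hy : 0 < y) : Real.exp (-y) ≤ y⁻¹ := by
  rw [Real.exp_neg]
  exact inv_anti₀ hy (by linarith [Real.add_one_le_exp y])

/-- Weakening `e^{-t}` to `1/t` leaves only geometric decay as `x → -∞`, but then both tails are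
controlled by the one series `hasSum_exp_tail`. -/
theorem dexp_le (p x : ℝ) : dexp p x ≤ Real.exp (-2 * L p * (-x)) := by
  refine (exp_neg_le_inv (Real.exp_pos _)).trans_eq ?_
  rw [← Real.exp_neg]
  congr 1; ring

theorem summable_dexp_sub {p : ℝ} (hp₀ : 0 < p) (hp₁ : p < 1) (x : ℝ) :
    Summable (fun k : ℕ => dexp p (x - k)) := by
  refine Summable.of_nonneg_of_le (fun _ => (dexp_pos _ _).le) (fun k => ?_)
    (hasSum_exp_tail hp₀ hp₁ (-x)).summable
  refine (dexp_le p _).trans_eq ?_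
  congr 2; ring

theorem summable_one_sub_dexp_add {p : ℝ} (hp₀ : 0 < p) (hp₁ : p < 1) (x : ℝ) :
    Summable (fun k : ℕ => 1 - dexp p (x + k)) :=
  Summable.of_nonneg_of_le (fun _ => by linarith [dexp_lt_one p (x + ‹ℕ›)])
    (fun k => one_sub_dexp_le p _) (hasSum_exp_tail hp₀ hp₁ x).summable

theorem summable_dexp_pnat {p : ℝ} (hp₀ : 0 < p) (hp₁ : p < 1) (x : ℝ) :
    Summable (fun k : ℕ+ => dexp p (x - (k : ℕ))) :=
  (summable_dexp_sub hp₀ hp₁ x).comp_injective PNat.coe_injective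

theorem multipliable_one_sub_dexp {p : ℝ} (hp₀ : 0 < p) (hp₁ : p < 1) (x : ℝ) :
    Multipliable (fun k : ℕ+ => 1 - dexp p (x - (k : ℕ))) := by
  simp_rw [sub_eq_add_neg (1 : ℝ)]
  apply multipliable_one_add_of_summable
  simpa [abs_of_pos (dexp_pos _ _)] using summable_dexp_pnat hp₀ hp₁ x

theorem tprod_one_sub_dexp_pos {p : ℝ} (hp₀ : 0 < p) (hp₁ : p < 1) (x : ℝ) :
    0 < ∏' k : ℕ+, (1 - dexp p (x - (k : ℕ))) := by
  refine lt_of_le_of_ne ?_ (Ne.symm ?_)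
  · exact ge_of_tendsto' (multipliable_one_sub_dexp hp₀ hp₁ x).hasProd fun s =>
      Finset.prod_nonneg fun k _ => by linarith [dexp_lt_one p (x - (k : ℕ))]
  · simp_rw [sub_eq_add_neg (1 : ℝ)]
    apply tprod_one_add_ne_zero_of_summable
    · intro k
      linarith [dexp_lt_one p (x - (k : ℕ))]
    · simpa [abs_of_pos (dexp_pos _ _)] using summable_dexp_pnat hp₀ hp₁ x

theorem tprod_one_sub_dexp_anti {p : ℝ} (hp₀ : 0 < p) (hp₁ : p < 1) {x y : ℝ} (hxy : x ≤ y) :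
    ∏' k : ℕ+, (1 - dexp p (y - (k : ℕ))) ≤ ∏' k : ℕ+, (1 - dexp p (x - (k : ℕ))) := by
  refine le_of_tendsto_of_tendsto' (multipliable_one_sub_dexp hp₀ hp₁ y).hasProd
    (multipliable_one_sub_dexp hp₀ hp₁ x).hasProd fun s => ?_
  refine Finset.prod_le_prod (fun k _ => by linarith [dexp_lt_one p (y - (k : ℕ))]) fun k _ => ?_
  have := dexp_mono hp₀ hp₁ (show x - (k : ℕ) ≤ y - (k : ℕ) by linarith)
  linarith

theorem Ψ_pos {p : ℝ} (hp₀ : 0 < p) (hp₁ : p < 1) (x : ℝ) : 0 < Ψ p x :=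
  mul_pos (dexp_pos _ _) (tprod_one_sub_dexp_pos hp₀ hp₁ x)

theorem tendsto_prod_one_sub_dexp {p : ℝ} (hp₀ : 0 < p) (hp₁ : p < 1) (x : ℝ) :
    Tendsto (fun N : ℕ => ∏ j ∈ Finset.range N, (1 - dexp p (x - (j + 1)))) atTop
      (𝓝 (∏' k : ℕ+, (1 - dexp p (x - (k : ℕ))))) := by
  have h : Multipliable (fun j : ℕ => 1 - dexp p (x - (j + 1 : ℕ))) :=
    (Equiv.pnatEquivNat.symm.multipliable_iff
      (f := fun k : ℕ+ => 1 - dexp p (x - (k : ℕ)))).2 (multipliable_one_sub_dexp hp₀ hp₁ x)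
  have := h.hasProd.tendsto_prod_nat
  rw [← tprod_pnat_eq_tprod_succ (f := fun j : ℕ => 1 - dexp p (x - j))] at this
  simpa using this

theorem α_mul_exp {p : ℝ} (hp₁ : p < 1) (x : ℝ) :
    α p * Real.exp (-2 * L p * x) =
      Real.exp (-2 * L p * (x + 1)) * (1 - (1 - p) ^ 2)⁻¹ := by
  have := exp_shift hp₁ x 1
  rw [Nat.cast_one] at this
  rw [this, α]
  ring

/-- The exponents form a geometric series, whose sum produces the constant `α`. This is the
probability that every bit beyond position `x` is false. -/
theorem tendsto_prod_dexp {p : ℝ} (hp₀ : 0 < p) (hp₁ : p < 1) (x : ℝ) :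
    Tendsto (fun N : ℕ => ∏ j ∈ Finset.range N, dexp p (x + 1 + j)) atTop
      (𝓝 (Real.exp (-α p * Real.exp (-2 * L p * x)))) := by
  simp only [dexp, ← Real.exp_sum, Finset.sum_neg_distrib]
  rw [neg_mul (α p), α_mul_exp hp₁]
  exact (Real.continuous_exp.tendsto _).comp (hasSum_exp_tail hp₀ hp₁ (x + 1)).tendsto_sum_nat.neg

end GeomPairs

/-! ### The model of independent bits, and `f`, `F` as the law of `total`. -/

namespace GeomPairs

/-- The law on `Bool` that gives mass `dexp p x` to `false`. -/
noncomputable def coin (p x : ℝ) : Measure Bool :=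
  ENNReal.ofReal (1 - dexp p x) • Measure.dirac true + ENNReal.ofReal (dexp p x) • Measure.dirac false

instance (p x : ℝ) : IsProbabilityMeasure (coin p x) := by
  constructor
  simp only [coin, Measure.coe_add, Measure.coe_smul, Pi.add_apply, Pi.smul_apply, measure_univ,
    smul_eq_mul, mul_one]
  rw [← ENNReal.ofReal_add (by linarith [dexp_lt_one p x]) (dexp_pos p x).le]
  simp

/-- The mass that `coin p x` gives to `b`. -/
noncomputable def coinMass (p x : ℝ) (b : Bool) : ℝ := if b then 1 - dexp p x else dexp p x

theorem coin_real_singleton (p x : ℝ) (b : Bool) : (coin p x).real {b} = coinMass p x b := by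
  cases b
  · simp [coin, coinMass, Measure.real, (dexp_pos p x).le]
  · simp [coin, coinMass, Measure.real, (dexp_lt_one p x).le]

/-- Independent bits indexed by `ℤ`; the bit at `i` is `false` with probability
`dexp p (y + i)`. -/
noncomputable def model (p y : ℝ) : Measure (ℤ → Bool) :=
  Measure.infinitePi fun i : ℤ => coin p (y + i)

instance (p y : ℝ) : IsProbabilityMeasure (model p y) := by
  unfold model; infer_instance

theorem model_real_cylinder (p y : ℝ) (s : Finset ℤ) (c : ℤ → Bool) :
    (model p y).real {ω | ∀ i ∈ s, ω i = c i} = ∏ i ∈ s, coinMass p (y + i) (c i) := by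
  have h : {ω : ℤ → Bool | ∀ i ∈ s, ω i = c i} = Set.pi s fun i => {c i} := by
    ext ω; simp [Set.mem_pi]
  rw [h, Measure.real, model, Measure.infinitePi_pi _ (by simp), ENNReal.toReal_prod]
  exact Finset.prod_congr rfl fun i _ => coin_real_singleton p _ _

theorem measurableSet_bit (i : ℤ) (b : Bool) : MeasurableSet {ω : ℤ → Bool | ω i = b} :=
  measurableSet_eq_fun (measurable_pi_apply i) measurable_const

theorem model_real_bit (p y : ℝ) (i : ℤ) (b : Bool) :
    (model p y).real {ω | ω i = b} = coinMass p (y + i) b := by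
  simpa using model_real_cylinder p y {i} fun _ => b

/-- All bits up to `a` are `true`, and only finitely many bits above `a` are. -/
def HasLevel (ω : ℤ → Bool) (a : ℤ) : Prop :=
  (∀ i ≤ a, ω i = true) ∧ {i | a < i ∧ ω i = true}.Finite

open Classical in
/-- The renormalised number of `true` bits: `a` plus the number of `true` bits above `a`. -/
noncomputable def total (ω : ℤ → Bool) : ℤ :=
  if h : ∃ a, HasLevel ω a then h.choose + {i | h.choose < i ∧ ω i = true}.ncard else 0

/-- Raising the level from `a` to `b` removes the `b - a` bits in `(a, b]` from the count, and all
of them are true. Hence `total` does not depend on the chosen level. -/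
theorem HasLevel.add_ncard_eq {ω : ℤ → Bool} {a b : ℤ} (hb : HasLevel ω b)
    (hab : a ≤ b) :
    a + ({i | a < i ∧ ω i = true}.ncard : ℤ) = b + {i | b < i ∧ ω i = true}.ncard := by
  have h : {i | a < i ∧ ω i = true} = (Finset.Ioc a b : Set ℤ) ∪ {i | b < i ∧ ω i = true} := by
    ext i
    simp only [Set.mem_ofPred_eq, Finset.coe_Ioc, Set.mem_union, Set.mem_Ioc]
    constructor
    · rintro ⟨h1, h2⟩
      by_cases h : i ≤ b
      · exact Or.inl ⟨h1, h⟩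
      · exact Or.inr ⟨by omega, h2⟩
    · rintro (⟨h1, h2⟩ | ⟨h1, h2⟩)
      · exact ⟨h1, hb.1 i h2⟩
      · exact ⟨by omega, h2⟩
  rw [h, Set.ncard_union_eq ?_ (Finset.finite_toSet _) hb.2, Set.ncard_coe_finset, Int.card_Ioc]
  · push_cast
    rw [Int.toNat_of_nonneg (by omega)]
    ring
  · rw [Set.disjoint_left]
    intro i hi hi'
    simp at hi hi'
    omega

theorem HasLevel.total_eq {ω : ℤ → Bool} {a : ℤ} (ha : HasLevel ω a) :
    total ω = a + {i | a < i ∧ ω i = true}.ncard := by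
  have h : ∃ a, HasLevel ω a := ⟨a, ha⟩
  rw [total, dif_pos h]
  rcases le_total h.choose a with hle | hle
  · exact ha.add_ncard_eq hle
  · exact (h.choose_spec.add_ncard_eq hle).symm

variable {p : ℝ}

/-- Borel–Cantelli; independence is not needed. -/
theorem ae_eventually_true (hp₀ : 0 < p) (hp₁ : p < 1) (y : ℝ) :
    ∀ᵐ ω ∂(model p y), ∀ᶠ k : ℕ in atTop, ω (-k) = true := by
  have h : ∑' k : ℕ, model p y {ω | ω (-k) = false} ≠ ⊤ := by
    have : ∀ k : ℕ, model p y {ω | ω (-k) = false} = ENNReal.ofReal (dexp p (y - k)) := by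
      intro k
      rw [← ofReal_measureReal, model_real_bit]
      simp [coinMass, sub_eq_add_neg]
    simp_rw [this]
    exact (summable_dexp_sub hp₀ hp₁ y).tsum_ofReal_ne_top
  filter_upwards [ae_eventually_notMem h] with ω hω
  filter_upwards [hω] with k hk
  simpa using hk

theorem ae_eventually_false (hp₀ : 0 < p) (hp₁ : p < 1) (y : ℝ) :
    ∀ᵐ ω ∂(model p y), ∀ᶠ k : ℕ in atTop, ω k = false := by
  have h : ∑' k : ℕ, model p y {ω | ω k = true} ≠ ⊤ := by
    have : ∀ k : ℕ, model p y {ω | ω k = true} = ENNReal.ofReal (1 - dexp p (y + k)) := by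
      intro k
      rw [← ofReal_measureReal, model_real_bit]
      simp [coinMass]
    simp_rw [this]
    exact (summable_one_sub_dexp_add hp₀ hp₁ y).tsum_ofReal_ne_top
  filter_upwards [ae_eventually_notMem h] with ω hω
  filter_upwards [hω] with k hk
  simpa using hk

/-- The configuration with first `false` bit at `m - v + 1` and `true` bits at `m + r j` above. -/
def config (m : ℤ) (σ : Σ v, Tuples v) (i : ℤ) : Bool :=
  decide (i ≤ m - σ.1 ∨ ∃ j, i = m + σ.2.1 j)

theorem config_true_iff (m : ℤ) (σ : Σ v, Tuples v) (i : ℤ) :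
    config m σ i = true ↔ i ≤ m - σ.1 ∨ ∃ j, i = m + σ.2.1 j := by simp [config]

theorem config_above (m : ℤ) (σ : Σ v, Tuples v) :
    {i | m - σ.1 < i ∧ config m σ i = true} = Set.range fun j => m + σ.2.1 j := by
  ext i
  simp only [Set.mem_ofPred_eq, config_true_iff, Set.mem_range]
  constructor
  · rintro ⟨h1, h2 | ⟨j, hj⟩⟩
    · omega
    · exact ⟨j, hj.symm⟩
  · rintro ⟨j, rfl⟩
    have := σ.2.2.2 j
    exact ⟨by omega, Or.inr ⟨j, rfl⟩⟩

theorem hasLevel_config (m : ℤ) (σ : Σ v, Tuples v) : HasLevel (config m σ) (m - σ.1) := by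
  refine ⟨fun i hi => (config_true_iff _ _ _).2 (Or.inl hi), ?_⟩
  rw [config_above]
  exact Set.finite_range _

theorem total_config (m : ℤ) (σ : Σ v, Tuples v) : total (config m σ) = m := by
  have hinj : Function.Injective fun j => m + σ.2.1 j :=
    fun a b h => σ.2.2.1.injective (by simpa using h)
  rw [(hasLevel_config m σ).total_eq, config_above, ← Set.image_univ,
    Set.ncard_image_of_injective _ hinj, Set.ncard_univ]
  simp

theorem config_first_false (m : ℤ) (σ : Σ v, Tuples v) : config m σ (m - σ.1 + 1) = false := by
  rw [← Bool.not_eq_true, config_true_iff]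
  rintro (h | ⟨j, hj⟩)
  · omega
  · have := σ.2.2.2 j
    omega

/-- The position of the first false bit determines `v`; the true bits above it determine the range
of the tuple, and a strictly monotone tuple is determined by its range. -/
theorem config_injective (m : ℤ) : Function.Injective (config m) := by
  intro σ τ h
  have key : ∀ σ τ : Σ v, Tuples v, config m σ = config m τ → τ.1 ≤ σ.1 := by
    intro σ τ h
    by_contra hlt
    have h1 := config_first_false m τ
    rw [← h, ← Bool.not_eq_true, config_true_iff] at h1
    exact h1 (Or.inl (by omega))
  have hv : σ.1 = τ.1 := le_antisymm (key _ _ h.symm) (key _ _ h)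
  obtain ⟨v, r⟩ := σ
  obtain ⟨w, s⟩ := τ
  obtain rfl : v = w := hv
  have hr : Set.range r.1 = Set.range s.1 := by
    have h1 := config_above m ⟨v, r⟩
    rw [h, show m - ((⟨v, r⟩ : Σ v, Tuples v).1 : ℤ) = m - ((⟨v, s⟩ : Σ v, Tuples v).1 : ℤ) from rfl,
      config_above] at h1
    ext i
    have := Set.ext_iff.1 h1 (m + i)
    simpa using this.symm
  have : r = s := Subtype.ext ((r.2.1.range_inj s.2.1).1 hr)
  rw [this]

theorem exists_config {ω : ℤ → Bool} (h1 : ∀ᶠ k : ℕ in atTop, ω (-k) = true)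
    (h2 : ∀ᶠ k : ℕ in atTop, ω k = false) : ∃ σ, ω = config (total ω) σ := by
  obtain ⟨K, hK⟩ := eventually_atTop.1 h1
  obtain ⟨N, hN⟩ := eventually_atTop.1 h2
  have hK' : ∀ i : ℤ, i ≤ -K → ω i = true := by
    intro i hi
    have := hK (-i).toNat (by omega)
    rwa [Int.toNat_of_nonneg (by omega), neg_neg] at this
  have hN' : ∀ i : ℤ, (N : ℤ) ≤ i → ω i = false := by
    intro i hi
    have := hN i.toNat (by omega)
    rwa [Int.toNat_of_nonneg (by omega)] at this
  -- With `k` the first false bit and `S` the true bits above it, `total ω = k - 1 + |S|`, so `v =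
  -- |S|` puts `k` at `total ω - v + 1`. Elements of `S` exceed `k`, which is the bound `r_j ≥ 2 -
  -- v`.
  obtain ⟨k, hk, hmin⟩ := Int.exists_least_of_bdd (P := fun i => ω i = false)
    ⟨-K, fun z hz => by
      by_contra hlt
      rw [hK' z (by omega)] at hz
      exact absurd hz (by simp)⟩ ⟨N, hN' N le_rfl⟩
  have hfin : {i | k - 1 < i ∧ ω i = true}.Finite := by
    refine (Set.finite_Ioo (k - 1) N).subset fun i hi => ⟨hi.1, ?_⟩
    by_contra hlt
    have := hN' i (by omega)
    simp [this] at hi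
  have hlev : HasLevel ω (k - 1) := by
    refine ⟨fun i hi => ?_, hfin⟩
    by_contra hne
    have := hmin i (by simpa using hne)
    omega
  set S := hfin.toFinset with hS
  have hcard : total ω = k - 1 + S.card := by
    rw [hlev.total_eq, Set.ncard_eq_toFinset_card _ hfin]
  have hmem : ∀ i, i ∈ S ↔ k - 1 < i ∧ ω i = true := fun i => by simp [hS]
  refine ⟨⟨S.card, fun j => S.orderEmbOfFin rfl j - total ω, ?_, ?_⟩, ?_⟩
  · intro a b hab
    have := (S.orderEmbOfFin rfl).strictMono hab
    simpa using this
  · intro j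
    have hj := (hmem _).1 (S.orderEmbOfFin_mem rfl j)
    have : S.orderEmbOfFin rfl j ≠ k := by
      intro h
      rw [h, hk] at hj
      exact absurd hj.2 (by simp)
    change 2 - (S.card : ℤ) ≤ S.orderEmbOfFin rfl j - total ω
    omega
  · funext i
    rw [Bool.eq_iff_iff, config_true_iff]
    simp only
    rw [hcard, show k - 1 + (S.card : ℤ) - S.card = k - 1 by ring]
    have hr : (∃ j, i = k - 1 + (S.card : ℤ) + (S.orderEmbOfFin rfl j - (k - 1 + (S.card : ℤ)))) ↔
        i ∈ S := by
      have : i ∈ S ↔ i ∈ Set.range (S.orderEmbOfFin rfl) := by simp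
      rw [this, Set.mem_range]
      exact exists_congr fun j => by constructor <;> intro h <;> linarith
    rw [hr, hmem]
    constructor
    · intro h
      by_cases hi : i ≤ k - 1
      · exact Or.inl hi
      · exact Or.inr ⟨by omega, h⟩
    · rintro (h | h)
      · exact hlev.1 i h
      · exact h.2

instance (v : ℕ) : Countable (Tuples v) := by
  unfold Tuples; infer_instance

theorem total_eq_ae (hp₀ : 0 < p) (hp₁ : p < 1) (y : ℝ) (m : ℤ) :
    {ω | total ω = m} =ᵐ[model p y] ⋃ σ, {config m σ} := by
  filter_upwards [ae_eventually_true hp₀ hp₁ y, ae_eventually_false hp₀ hp₁ y] with ω h1 h2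
  apply propext
  change total ω = m ↔ ω ∈ ⋃ σ, {config m σ}
  rw [Set.mem_iUnion]
  constructor
  · rintro rfl
    exact exists_config h1 h2
  · rintro ⟨σ, rfl⟩
    exact total_config m σ

theorem hasSum_model_config (hp₀ : 0 < p) (hp₁ : p < 1) (y : ℝ) (m : ℤ) :
    HasSum (fun σ => (model p y).real {config m σ}) ((model p y).real {ω | total ω = m}) := by
  have h : model p y {ω | total ω = m} = ∑' σ, model p y {config m σ} := by
    rw [measure_congr (total_eq_ae hp₀ hp₁ y m), measure_iUnion]
    · intro σ τ hne
      simpa [Function.onFun] using fun h => hne (config_injective m h)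
    · exact fun _ => measurableSet_singleton _
  rw [Measure.real, h, ENNReal.tsum_toReal_eq fun _ => measure_ne_top _ _]
  exact ENNReal.hasSum_toReal (h ▸ measure_ne_top _ _)

theorem prod_Icc_symm {M : Type*} [CommMonoid M] (g : ℤ → M) (k : ℤ) (N : ℕ) :
    ∏ i ∈ Finset.Icc (k - N) (k + N), g i =
      g k * (∏ j ∈ Finset.range N, g (k - (j + 1))) * ∏ j ∈ Finset.range N, g (k + 1 + j) := by
  induction N with
  | zero => simp
  | succ N ih =>
    have h : Finset.Icc (k - (N + 1 : ℕ)) (k + (N + 1 : ℕ)) =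
        insert (k - (N + 1)) (insert (k + 1 + N) (Finset.Icc (k - N) (k + N))) := by
      ext i
      simp only [Finset.mem_insert, Finset.mem_Icc]
      push_cast
      omega
    rw [h, Finset.prod_insert, Finset.prod_insert, ih, Finset.prod_range_succ,
      Finset.prod_range_succ]
    · ac_rfl
    · simp only [Finset.mem_Icc]; omega
    · simp only [Finset.mem_insert, Finset.mem_Icc]; omega

/-- The offset of a tuple entry from the smallest admissible value. -/
def tupleOffset {v : ℕ} (r : Tuples v) (j : Fin v) : ℕ := (r.1 j - (2 - v)).toNat

theorem tupleOffset_cast {v : ℕ} (r : Tuples v) (j : Fin v) :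
    (tupleOffset r j : ℤ) = r.1 j - (2 - v) :=
  Int.toNat_of_nonneg (by linarith [r.2.2 j])

theorem tupleOffset_injective {v : ℕ} (r : Tuples v) : Function.Injective (tupleOffset r) := by
  intro a b h
  have := congrArg (Nat.cast : ℕ → ℤ) h
  rw [tupleOffset_cast, tupleOffset_cast] at this
  exact r.2.1.injective (by linarith)

/-- Relative to the all-false configuration, only the places of the tuple contribute a factor other
than `1`. This explains the quotients in `tupleWeight`. -/
theorem hasProd_coinMass_div (y : ℝ) (m : ℤ) (v : ℕ) (r : Tuples v) :
    HasProd (fun j : ℕ => coinMass p (y + (m - v + 1 + 1 + j : ℤ)) (config m ⟨v, r⟩ (m - v + 1 + 1 + j))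
      / dexp p (y + (m - v + 1 + 1 + j : ℤ))) (tupleWeight p (y + m) v r) := by
  have hoff : ∀ j, m - v + 1 + 1 + (tupleOffset r j : ℤ) = m + r.1 j := by
    intro j; rw [tupleOffset_cast]; ring
  refine ((tupleOffset_injective r).hasProd_iff ?_).1 ?_
  · intro j hj
    have hc : config m ⟨v, r⟩ (m - v + 1 + 1 + j) = false := by
      rw [← Bool.not_eq_true, config_true_iff]
      rintro (h | ⟨i, hi⟩)
      · simp only at h
        omega
      · simp only at hi
        rw [← hoff] at hi
        exact hj ⟨i, by omega⟩
    rw [hc]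
    simp [coinMass, (dexp_pos p _).ne']
  · have : ((fun j : ℕ => coinMass p (y + (m - v + 1 + 1 + j : ℤ))
        (config m ⟨v, r⟩ (m - v + 1 + 1 + j)) / dexp p (y + (m - v + 1 + 1 + j : ℤ))) ∘
        tupleOffset r) =
        fun j => (1 - dexp p (y + m + r.1 j)) / dexp p (y + m + r.1 j) := by
      funext j
      have hc : config m ⟨v, r⟩ (m + r.1 j) = true := (config_true_iff _ _ _).2 (Or.inr ⟨j, rfl⟩)
      simp only [Function.comp_apply, hoff, hc, coinMass, if_true]
      push_cast
      rw [add_assoc]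
    rw [this]
    exact hasProd_fintype _

/-- A single configuration is the decreasing intersection of cylinders on boxes centred at its first
false bit `k`. The centre and the left half of the box converge to `Ψ`; the right half converges to
the all-false probability times the tuple weight. -/
theorem model_real_config (hp₀ : 0 < p) (hp₁ : p < 1) (y : ℝ) (m : ℤ) (v : ℕ) (r : Tuples v) :
    (model p y).real {config m ⟨v, r⟩} =
      Ψ p (y + m - v + 1) * Real.exp (-α p * Real.exp (-2 * L p * (y + m + 1 - v))) *
        tupleWeight p (y + m) v r := by
  set k : ℤ := m - v + 1 with hk
  set c := config m ⟨v, r⟩ with hc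
  have hbox : {c} = ⋂ N : ℕ, {ω : ℤ → Bool | ∀ i ∈ Finset.Icc (k - N) (k + N), ω i = c i} := by
    ext ω
    simp only [Set.mem_singleton_iff, Set.mem_iInter, Set.mem_ofPred_eq, Finset.mem_Icc]
    refine ⟨fun h N i _ => by rw [h], fun h => funext fun i => h (i - k).natAbs i ?_⟩
    omega
  have hlim : Tendsto (fun N : ℕ =>
      (model p y).real {ω : ℤ → Bool | ∀ i ∈ Finset.Icc (k - N) (k + N), ω i = c i}) atTop
      (𝓝 ((model p y).real {c})) := by
    rw [hbox]
    refine (ENNReal.tendsto_toReal (measure_ne_top _ _)).comp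
      (tendsto_measure_iInter_atTop (fun N => ?_) ?_ ⟨0, measure_ne_top _ _⟩)
    · refine MeasurableSet.nullMeasurableSet ?_
      simp only [Set.ofPred_forall]
      exact .iInter fun i => .iInter fun _ => measurableSet_bit i _
    · intro M N hMN ω hω i hi
      refine hω i ?_
      simp only [Finset.mem_Icc] at hi ⊢
      omega
  refine tendsto_nhds_unique hlim ?_
  simp_rw [model_real_cylinder, prod_Icc_symm]
  have hck : c k = false := config_first_false m ⟨v, r⟩
  have hcl : ∀ j : ℕ, c (k - (j + 1)) = true := fun j =>
    (config_true_iff _ _ _).2 (Or.inl (by simp only; omega))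
  have h1 := tendsto_prod_one_sub_dexp hp₀ hp₁ (y + k)
  have h2 := tendsto_prod_dexp hp₀ hp₁ (y + k)
  have h3 := (hasProd_coinMass_div (p := p) y m v r).tendsto_prod_nat
  have h4 := ((h1.const_mul (dexp p (y + k))).mul h2).mul h3
  have e1 : y + m - v + 1 = y + (k : ℝ) := by rw [hk]; push_cast; ring
  have e2 : y + m + 1 - v = y + (k : ℝ) := by rw [hk]; push_cast; ring
  rw [e1, e2, Ψ]
  refine h4.congr fun N => ?_
  rw [mul_assoc _ (∏ j ∈ Finset.range N, dexp p _), ← Finset.prod_mul_distrib]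
  congr 1
  · congr 1
    · simp [coinMass, hck]
    · refine Finset.prod_congr rfl fun j _ => ?_
      rw [hcl]
      simp only [coinMass, if_true]
      push_cast
      congr 2; ring
  · refine Finset.prod_congr rfl fun j _ => ?_
    rw [show y + (k : ℝ) + 1 + j = y + (k + 1 + j : ℤ) by push_cast; ring]
    exact mul_div_cancel₀ _ (dexp_pos p _).ne'

theorem summable_tupleWeight (hp₀ : 0 < p) (hp₁ : p < 1) (η : ℝ) (v : ℕ) :
    Summable (tupleWeight p η v) := by
  have h := (hasSum_model_config hp₀ hp₁ η 0).summable.sigma_factor v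
  simp_rw [model_real_config hp₀ hp₁] at h
  rw [summable_mul_left_iff (mul_pos (Ψ_pos hp₀ hp₁ _) (Real.exp_pos _)).ne'] at h
  simpa using h

theorem tsum_model_config (hp₀ : 0 < p) (hp₁ : p < 1) (y : ℝ) (m : ℤ) (v : ℕ) :
    ∑' r : Tuples v, (model p y).real {config m ⟨v, r⟩} = fTerm p (y + m) v := by
  simp_rw [model_real_config hp₀ hp₁, tsum_mul_left]
  rfl

theorem summable_fTerm (hp₀ : 0 < p) (hp₁ : p < 1) (η : ℝ) : Summable (fTerm p η) := by
  have h := (hasSum_model_config hp₀ hp₁ η 0).summable.sigma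
  simp_rw [tsum_model_config hp₀ hp₁] at h
  simpa using h

/-- Up to a null set, `total = m` is the disjoint union of the countably many configurations;
summing over tuples first and then over `v` gives the series of `f`. -/
theorem f_add_eq (hp₀ : 0 < p) (hp₁ : p < 1) (y : ℝ) (m : ℤ) :
    f p (y + m) = (model p y).real {ω | total ω = m} := by
  have h := hasSum_model_config hp₀ hp₁ y m
  rw [← h.tsum_eq, h.summable.tsum_sigma]
  simp_rw [tsum_model_config hp₀ hp₁]
  rfl

theorem nullMeasurableSet_total_eq (hp₀ : 0 < p) (hp₁ : p < 1) (y : ℝ) (m : ℤ) :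
    NullMeasurableSet {ω | total ω = m} (model p y) :=
  (MeasurableSet.iUnion fun _ => measurableSet_singleton _).nullMeasurableSet.congr
    (total_eq_ae hp₀ hp₁ y m).symm

theorem hasSum_f_sub (hp₀ : 0 < p) (hp₁ : p < 1) (y : ℝ) (m : ℤ) :
    HasSum (fun i : ℕ => f p (y + m - i)) ((model p y).real {ω | total ω ≤ m}) := by
  have hU : {ω | total ω ≤ m} = ⋃ i : ℕ, {ω | total ω = m - i} := by
    ext ω
    simp only [Set.mem_ofPred_eq, Set.mem_iUnion]
    exact ⟨fun h => ⟨(m - total ω).toNat, by omega⟩, fun ⟨i, hi⟩ => by omega⟩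
  have h : model p y {ω | total ω ≤ m} = ∑' i : ℕ, model p y {ω | total ω = m - i} := by
    rw [hU, measure_iUnion₀]
    · intro i j hne
      refine Disjoint.aedisjoint (Set.disjoint_left.2 fun ω hi hj => hne ?_)
      simp only [Set.mem_ofPred_eq] at hi hj
      omega
    · exact fun i => nullMeasurableSet_total_eq hp₀ hp₁ y _
  have hf : ∀ i : ℕ, f p (y + m - i) = (model p y {ω | total ω = m - i}).toReal := by
    intro i
    rw [← Measure.real, ← f_add_eq hp₀ hp₁]
    push_cast
    rw [add_sub_assoc]
  simp_rw [hf]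
  rw [Measure.real, h, ENNReal.tsum_toReal_eq fun _ => measure_ne_top _ _]
  exact ENNReal.hasSum_toReal (h ▸ measure_ne_top _ _)

theorem F_add_eq (hp₀ : 0 < p) (hp₁ : p < 1) (y : ℝ) (m : ℤ) :
    F p (y + m) = (model p y).real {ω | total ω ≤ m} :=
  (hasSum_f_sub hp₀ hp₁ y m).tsum_eq

/-! ### Lower bounds for `f` and `F`. -/

theorem tupleWeight_nonneg (p η : ℝ) (v : ℕ) (r : Tuples v) : 0 ≤ tupleWeight p η v r :=
  Finset.prod_nonneg fun _ _ => div_nonneg (by linarith [dexp_lt_one p (η + (r.1 ‹_› : ℝ))])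
    (dexp_pos _ _).le

theorem fTerm_nonneg (hp₀ : 0 < p) (hp₁ : p < 1) (η : ℝ) (v : ℕ) : 0 ≤ fTerm p η v :=
  mul_nonneg (mul_nonneg (Ψ_pos hp₀ hp₁ _).le (Real.exp_pos _).le)
    (tsum_nonneg fun _ => tupleWeight_nonneg _ _ _ _)

theorem fTerm_zero (p η : ℝ) :
    fTerm p η 0 = Ψ p (η + 1) * Real.exp (-α p * Real.exp (-2 * L p * (η + 1))) := by
  let r₀ : Tuples 0 := ⟨Fin.elim0, fun a => a.elim0, fun a => a.elim0⟩
  have h : ∑' r : Tuples 0, tupleWeight p η 0 r = 1 := by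
    rw [tsum_eq_single r₀ fun r hr => absurd (Subtype.ext (Subsingleton.elim _ _)) hr]
    simp [tupleWeight]
  simp [fTerm, h]

theorem α_nonneg (hp₀ : 0 < p) (hp₁ : p < 1) : 0 ≤ α p :=
  div_nonneg (sq_nonneg _) (by linarith [ratio_lt_one hp₀ hp₁])

/-- The term `v = 0` suffices. Each of its factors is monotone in `η`, so it is bounded by its value
at an endpoint: `M` for the decreasing infinite product, `-M` for the other two. -/
theorem exists_pos_le_f (hp₀ : 0 < p) (hp₁ : p < 1) (M : ℝ) :
    ∃ c, 0 < c ∧ ∀ η, |η| ≤ M → c ≤ f p η := by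
  refine ⟨dexp p (-M + 1) * (∏' k : ℕ+, (1 - dexp p (M + 1 - (k : ℕ)))) *
    Real.exp (-α p * Real.exp (-2 * L p * (-M + 1))),
    mul_pos (mul_pos (dexp_pos _ _) (tprod_one_sub_dexp_pos hp₀ hp₁ _)) (Real.exp_pos _), ?_⟩
  intro η hη
  obtain ⟨h1, h2⟩ := abs_le.1 hη
  refine le_trans ?_ ((summable_fTerm hp₀ hp₁ η).le_tsum 0 fun v _ => fTerm_nonneg hp₀ hp₁ η v)
  rw [fTerm_zero, Ψ]
  have hL := L_pos hp₀ hp₁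
  have hα := α_nonneg hp₀ hp₁
  refine mul_le_mul (mul_le_mul (dexp_mono hp₀ hp₁ (by linarith))
    (tprod_one_sub_dexp_anti hp₀ hp₁ (by linarith)) (tprod_one_sub_dexp_pos hp₀ hp₁ _).le
    (dexp_pos _ _).le) (Real.exp_le_exp.2 ?_) (Real.exp_pos _).le (Ψ_pos hp₀ hp₁ _).le
  rw [neg_mul, neg_mul (α p), neg_le_neg_iff]
  refine mul_le_mul_of_nonneg_left (Real.exp_le_exp.2 ?_) hα
  nlinarith

theorem f_le_F (hp₀ : 0 < p) (hp₁ : p < 1) (η : ℝ) : f p η ≤ F p η := by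
  have h := (hasSum_f_sub hp₀ hp₁ η 0).summable
  simp only [Int.cast_zero, add_zero] at h
  have := h.le_tsum 0 fun i _ => tsum_nonneg fun v => fTerm_nonneg hp₀ hp₁ _ v
  simpa [F] using this

end GeomPairs

/-! ### Avoidance probabilities of the random string. -/

namespace GeomPairs

/-- A sequence that satisfies the one-step recurrence of the avoidance probabilities is close to a
geometric sequence. -/
theorem abs_sub_pow_le_of_recurrence {ι : Type*} (S : Finset ι) (P : ι → ℝ) (a : ℕ → ℝ)
    (e : ℕ → ι → ℝ) (hP : ∀ i ∈ S, 0 ≤ P i) {δ : ℝ} (hδ : ∀ i ∈ S, P i ≤ δ)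
    (hs : ∑ i ∈ S, P i ^ 2 ≤ δ) (hs1 : ∑ i ∈ S, P i ^ 2 ≤ 1) (ha0 : a 0 = 1)
    (he0 : ∀ i ∈ S, e 0 i = P i) (he : ∀ n, ∀ i ∈ S, 0 ≤ e n i ∧ e n i ≤ P i)
    (hes : ∀ n, ∀ i ∈ S, e (n + 1) i = (a n - e n i) * P i)
    (has : ∀ n, a (n + 1) = a n - ∑ i ∈ S, e n i * P i) (n : ℕ) :
    |a n - (1 - ∑ i ∈ S, P i ^ 2) ^ n| ≤ n * ((∑ i ∈ S, P i ^ 2) * δ) := by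
  set s := ∑ i ∈ S, P i ^ 2 with hsdef
  have hs0 : 0 ≤ s := Finset.sum_nonneg fun i _ => sq_nonneg _
  have hdiff : ∀ n, 0 ≤ a n - a (n + 1) ∧ a n - a (n + 1) ≤ s := by
    intro n
    rw [has, sub_sub_cancel]
    refine ⟨Finset.sum_nonneg fun i hi => mul_nonneg (he n i hi).1 (hP i hi),
      Finset.sum_le_sum fun i hi => ?_⟩
    rw [sq]
    exact mul_le_mul_of_nonneg_right (he n i hi).2 (hP i hi)
  -- The last letter is nearly independent of avoidance: `e n i - P i * a n` is `P i` times a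
  -- difference of two quantities in `[0, δ]`, namely the one-step loss of `a` and the previous `e`.
  have hclose : ∀ n, ∀ i ∈ S, |e n i - P i * a n| ≤ P i * δ := by
    intro n i hi
    have hPδ : 0 ≤ P i * δ := mul_nonneg (hP i hi) ((hP i hi).trans (hδ i hi))
    cases n with
    | zero => simpa [he0 i hi, ha0] using hPδ
    | succ n =>
      rw [hes n i hi, show (a n - e n i) * P i - P i * a (n + 1) =
        P i * (a n - a (n + 1) - e n i) by ring, abs_mul, abs_of_nonneg (hP i hi)]
      refine mul_le_mul_of_nonneg_left ?_ (hP i hi)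
      rw [abs_le]
      have := hdiff n
      have := he n i hi
      have := hδ i hi
      constructor <;> linarith
  induction n with
  | zero => simp [ha0]
  | succ n ih =>
    have h1 : a (n + 1) - (1 - s) * a n = -∑ i ∈ S, (e n i - P i * a n) * P i := by
      simp only [sub_mul, Finset.sum_sub_distrib]
      rw [has, hsdef, Finset.sum_mul]
      have : ∑ i ∈ S, P i * a n * P i = ∑ i ∈ S, P i ^ 2 * a n :=
        Finset.sum_congr rfl fun i _ => by ring
      rw [this]
      ring
    have h2 : |a (n + 1) - (1 - s) * a n| ≤ s * δ := by
      rw [h1, abs_neg, hsdef, Finset.sum_mul]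
      refine (Finset.abs_sum_le_sum_abs _ _).trans (Finset.sum_le_sum fun i hi => ?_)
      rw [abs_mul, abs_of_nonneg (hP i hi)]
      have := mul_le_mul_of_nonneg_right (hclose n i hi) (hP i hi)
      linarith
    have h3 : |(1 - s) * (a n - (1 - s) ^ n)| ≤ n * (s * δ) := by
      rw [abs_mul]
      refine (mul_le_of_le_one_left (abs_nonneg _) ?_).trans ih
      rw [abs_le]; constructor <;> linarith
    have h4 : a (n + 1) - (1 - s) ^ (n + 1) =
        (a (n + 1) - (1 - s) * a n) + (1 - s) * (a n - (1 - s) ^ n) := by ring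
    rw [h4]
    refine (abs_add_le _ _).trans ?_
    push_cast
    linarith

theorem abs_pow_sub_pow_le_of_le_one {x y : ℝ} (hx : |x| ≤ 1) (hy : |y| ≤ 1) (n : ℕ) :
    |x ^ n - y ^ n| ≤ n * |x - y| := by
  induction n with
  | zero => simp
  | succ n ih =>
    have h : x ^ (n + 1) - y ^ (n + 1) = x * (x ^ n - y ^ n) + (x - y) * y ^ n := by ring
    rw [h]
    refine (abs_add_le _ _).trans ?_
    rw [abs_mul, abs_mul, abs_pow]
    have h1 := mul_le_of_le_one_left (abs_nonneg (x ^ n - y ^ n)) hx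
    have h2 := mul_le_of_le_one_right (abs_nonneg (x - y)) (pow_le_one₀ (abs_nonneg y) hy (n := n))
    push_cast
    linarith

/-- Avoiding `n` pairs involves `n + 1` letters, and the Poisson parameter counts letters. The extra
factor `e^{-s}` costs the summand `s`. -/
theorem abs_one_sub_pow_sub_exp_le {s : ℝ} (hs0 : 0 ≤ s) (hs1 : s ≤ 1) (n : ℕ) :
    |(1 - s) ^ n - Real.exp (-((n + 1 : ℕ) * s))| ≤ n * s ^ 2 + s := by
  have h1 : |(1 - s) ^ n - Real.exp (-s) ^ n| ≤ n * s ^ 2 := by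
    refine (abs_pow_sub_pow_le_of_le_one ?_ ?_ n).trans ?_
    · rw [abs_le]; constructor <;> linarith
    · rw [abs_of_pos (Real.exp_pos _)]
      exact Real.exp_le_one_iff.2 (by linarith)
    · refine mul_le_mul_of_nonneg_left ?_ (Nat.cast_nonneg _)
      have := Real.abs_exp_sub_one_sub_id_le (x := -s) (by rwa [abs_neg, abs_of_nonneg hs0])
      rw [abs_sub_comm]
      calc _ = |Real.exp (-s) - 1 - -s| := by congr 1; ring
        _ ≤ _ := by simpa using this
  have h2 : |Real.exp (-s) ^ n - Real.exp (-((n + 1 : ℕ) * s))| ≤ s := by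
    have he : Real.exp (-((n + 1 : ℕ) * s)) = Real.exp (-s) ^ n * Real.exp (-s) := by
      rw [← pow_succ, ← Real.exp_nat_mul]; congr 1; ring
    rw [he, ← mul_one_sub, abs_mul, abs_of_nonneg (pow_nonneg (Real.exp_pos _).le n)]
    have h3 : Real.exp (-s) ≤ 1 := Real.exp_le_one_iff.2 (by linarith)
    have h4 := Real.add_one_le_exp (-s)
    rw [abs_of_nonneg (by linarith)]
    refine (mul_le_of_le_one_left (by linarith) (pow_le_one₀ (Real.exp_pos _).le h3)).trans ?_
    linarith
  exact (abs_sub_le _ _ _).trans (add_le_add h1 h2)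

section String

variable {Ω : Type*} {Z : ℕ → Ω → ℕ} {S : Finset ℕ}

/-- An event determined by finitely many letters is a preimage from a countable discrete space, so
measurability and independence of the next letter come for free. -/
theorem exists_preimage_of_dependsOn {n : ℕ} {T : Set Ω}
    (hT : ∀ ω ω', (∀ k ≤ n, Z k ω = Z k ω') → ω ∈ T → ω' ∈ T) :
    ∃ T' : Set (Finset.range (n + 1) → ℕ),
      T = (fun ω (j : Finset.range (n + 1)) => Z j ω) ⁻¹' T' := by
  refine ⟨(fun ω (j : Finset.range (n + 1)) => Z j ω) '' T, Set.Subset.antisymm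
    (Set.subset_preimage_image _ _) ?_⟩
  rintro ω ⟨ω', hω', h⟩
  refine hT ω' ω (fun k hk => ?_) hω'
  exact congrFun h ⟨k, Finset.mem_range.2 (by omega)⟩

/-- None of the first `n` consecutive pairs consists of two equal letters from `S`. -/
def avoid (Z : ℕ → Ω → ℕ) (S : Finset ℕ) (n : ℕ) : Set Ω :=
  {ω | ∀ k < n, Z k ω = Z (k + 1) ω → Z k ω ∉ S}

theorem avoid_zero : avoid Z S 0 = Set.univ := by
  ext ω; simp [avoid]

theorem avoid_dependsOn (S : Finset ℕ) (n : ℕ) (ω ω' : Ω) (h : ∀ k ≤ n, Z k ω = Z k ω')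
    (hω : ω ∈ avoid Z S n) : ω' ∈ avoid Z S n := by
  intro k hk
  rw [← h k (by omega), ← h (k + 1) (by omega)]
  exact hω k hk

variable [MeasurableSpace Ω] {μ : Measure Ω} {p : ℝ}

theorem IsGeometricSequence.measurableSet (hZ : IsGeometricSequence μ p Z) {n : ℕ}
    {T : Set Ω} (hT : ∀ ω ω', (∀ k ≤ n, Z k ω = Z k ω') → ω ∈ T → ω' ∈ T) : MeasurableSet T := by
  obtain ⟨T', rfl⟩ := exists_preimage_of_dependsOn hT
  exact (measurable_pi_lambda _ fun j : Finset.range (n + 1) => hZ.measurable j)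
    (MeasurableSet.of_discrete)

theorem IsGeometricSequence.real_inter_next (hZ : IsGeometricSequence μ p Z) {n : ℕ}
    {T : Set Ω} (hT : ∀ ω ω', (∀ k ≤ n, Z k ω = Z k ω') → ω ∈ T → ω' ∈ T) {i : ℕ} (hi : 1 ≤ i) :
    μ.real (T ∩ {ω | Z (n + 1) ω = i}) = μ.real T * letterProb p i := by
  obtain ⟨T', rfl⟩ := exists_preimage_of_dependsOn hT
  have h := hZ.indep.indepFun_finset (Finset.range (n + 1)) {n + 1} (by simp) hZ.measurable
  have h2 := h.measure_inter_preimage_eq_mul T' {x | x ⟨n + 1, by simp⟩ = i}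
    MeasurableSet.of_discrete MeasurableSet.of_discrete
  rw [← hZ.law (n + 1) i hi, Measure.real, Measure.real, Measure.real, ← ENNReal.toReal_mul]
  exact congrArg ENNReal.toReal h2

theorem IsGeometricSequence.measurableSet_avoid (hZ : IsGeometricSequence μ p Z) (S : Finset ℕ)
    (n : ℕ) : MeasurableSet (avoid Z S n) :=
  hZ.measurableSet (avoid_dependsOn S n)

theorem IsGeometricSequence.measurableSet_eq (hZ : IsGeometricSequence μ p Z) (n i : ℕ) :
    MeasurableSet {ω | Z n ω = i} :=
  measurableSet_eq_fun (hZ.measurable n) measurable_const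

variable [IsProbabilityMeasure μ]

/-- If the new letter is `i ∈ S`, the new pair is harmless exactly when the preceding letter is not
`i`. With `real_avoid_succ` this closes the recurrence. -/
theorem IsGeometricSequence.real_avoid_last (hZ : IsGeometricSequence μ p Z)
    (n : ℕ) {i : ℕ} (hi : i ∈ S) (hi1 : 1 ≤ i) :
    μ.real (avoid Z S (n + 1) ∩ {ω | Z (n + 1) ω = i}) =
      (μ.real (avoid Z S n) - μ.real (avoid Z S n ∩ {ω | Z n ω = i})) * letterProb p i := by
  have h : avoid Z S (n + 1) ∩ {ω | Z (n + 1) ω = i} =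
      (avoid Z S n \ {ω | Z n ω = i}) ∩ {ω | Z (n + 1) ω = i} := by
    ext ω
    simp only [avoid, Set.mem_inter_iff, Set.mem_sdiff, Set.mem_ofPred_eq, and_congr_left_iff]
    intro hω
    constructor
    · refine fun h => ⟨fun k hk => h k (by omega), fun hn => ?_⟩
      exact h n (by omega) (by rw [hn, hω]) (by rwa [hn])
    · rintro ⟨h, hn⟩ k hk
      rcases Nat.lt_succ_iff_lt_or_eq.1 hk with hk | rfl
      · exact h k hk
      · intro heq
        exact absurd (heq.trans hω) hn
  rw [h, hZ.real_inter_next ?_ hi1, ← measureReal_inter_add_sdiff (s := avoid Z S n)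
    (hZ.measurableSet_eq n i), add_sub_cancel_left]
  rintro ω ω' h ⟨h1, h2⟩
  refine ⟨avoid_dependsOn S n ω ω' h h1, ?_⟩
  simpa [← h n le_rfl] using h2

theorem IsGeometricSequence.real_avoid_succ (hZ : IsGeometricSequence μ p Z)
    (hS : ∀ i ∈ S, 1 ≤ i) (n : ℕ) :
    μ.real (avoid Z S (n + 1)) = μ.real (avoid Z S n) -
      ∑ i ∈ S, μ.real (avoid Z S n ∩ {ω | Z n ω = i}) * letterProb p i := by
  have h : avoid Z S n \ avoid Z S (n + 1) =
      ⋃ i ∈ S, (avoid Z S n ∩ {ω | Z n ω = i}) ∩ {ω | Z (n + 1) ω = i} := by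
    ext ω
    simp only [avoid, Set.mem_inter_iff, Set.mem_sdiff, Set.mem_ofPred_eq, Set.mem_iUnion]
    constructor
    · rintro ⟨h1, h2⟩
      push Not at h2
      obtain ⟨k, hk, heq, hm⟩ := h2
      rcases Nat.lt_succ_iff_lt_or_eq.1 hk with hk | rfl
      · exact absurd hm (h1 k hk heq)
      · exact ⟨_, hm, ⟨h1, rfl⟩, heq.symm⟩
    · rintro ⟨i, hi, ⟨h1, h2⟩, h3⟩
      refine ⟨h1, fun h => h n (by omega) (by rw [h2, h3]) (by rwa [h2])⟩
  have hsub : avoid Z S (n + 1) ⊆ avoid Z S n := fun ω hω k hk => hω k (by omega)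
  have h1 := measureReal_sdiff (μ := μ) hsub (hZ.measurableSet_avoid S (n + 1))
  rw [h, measureReal_biUnion_finset] at h1
  · have h2 : ∀ i ∈ S, μ.real ((avoid Z S n ∩ {ω | Z n ω = i}) ∩ {ω | Z (n + 1) ω = i}) =
        μ.real (avoid Z S n ∩ {ω | Z n ω = i}) * letterProb p i := by
      intro i hi
      refine hZ.real_inter_next ?_ (hS i hi)
      rintro ω ω' h ⟨h1, h2⟩
      refine ⟨avoid_dependsOn S n ω ω' h h1, ?_⟩
      simpa [← h n le_rfl] using h2
    rw [Finset.sum_congr rfl h2] at h1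
    linarith
  · intro i _ j _ hij
    refine Set.disjoint_left.2 fun ω hi hj => hij ?_
    exact hi.2.symm.trans hj.2
  · intro i _
    exact ((hZ.measurableSet_avoid S n).inter (hZ.measurableSet_eq n i)).inter
      (hZ.measurableSet_eq _ i)

theorem letterProb_nonneg (hp₀ : 0 < p) (hp₁ : p < 1) (i : ℕ) : 0 ≤ letterProb p i :=
  mul_nonneg hp₀.le (pow_nonneg (by linarith) _)

theorem IsGeometricSequence.real_avoid_inter_le (hZ : IsGeometricSequence μ p Z) (n : ℕ) {i : ℕ}
    (hi : 1 ≤ i) : μ.real (avoid Z S n ∩ {ω | Z n ω = i}) ≤ letterProb p i := by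
  rw [← hZ.law n i hi]
  exact measureReal_mono Set.inter_subset_right

theorem IsGeometricSequence.abs_real_avoid_sub_le (hZ : IsGeometricSequence μ p Z)
    (hp₀ : 0 < p) (hp₁ : p < 1) (hS : ∀ i ∈ S, 1 ≤ i) {δ : ℝ} (hδ1 : δ ≤ 1)
    (hδ : ∀ i ∈ S, letterProb p i ≤ δ) (hs : ∑ i ∈ S, letterProb p i ^ 2 ≤ δ) (n : ℕ) :
    |μ.real (avoid Z S n) - Real.exp (-((n + 1 : ℕ) * ∑ i ∈ S, letterProb p i ^ 2))| ≤
      2 * ((n + 1 : ℕ) * ∑ i ∈ S, letterProb p i ^ 2) * δ + δ := by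
  have hP := letterProb_nonneg hp₀ hp₁
  set s := ∑ i ∈ S, letterProb p i ^ 2 with hsdef
  have hs0 : 0 ≤ s := Finset.sum_nonneg fun i _ => sq_nonneg _
  have h1 := abs_sub_pow_le_of_recurrence S (letterProb p) (fun n => μ.real (avoid Z S n))
    (fun n i => μ.real (avoid Z S n ∩ {ω | Z n ω = i})) (fun i _ => hP i) hδ hs (hs.trans hδ1)
    (by simp [avoid_zero]) (fun i hi => by simpa [avoid_zero] using hZ.law 0 i (hS i hi))
    (fun n i hi => ⟨measureReal_nonneg, hZ.real_avoid_inter_le n (hS i hi)⟩)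
    (fun n i hi => hZ.real_avoid_last n hi (hS i hi)) (hZ.real_avoid_succ hS) n
  have h2 := abs_one_sub_pow_sub_exp_le hs0 (hs.trans hδ1) n
  refine (abs_sub_le _ _ _).trans ((add_le_add h1 h2).trans ?_)
  have h3 : (n : ℝ) * s ^ 2 ≤ n * (s * δ) := by
    rw [sq]; gcongr
  have h4 : 0 ≤ s * δ := mul_nonneg hs0 (hs0.trans hs)
  push_cast
  nlinarith

/-- Writing `e` for the probability of avoiding and ending in `i`, two steps of the recurrence leave
`(1 - P_i²) a - e P_i (1 - P_i)`. No smallness of `P_i` is needed, so the bound serves the letters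
below the window. -/
theorem IsGeometricSequence.real_avoid_singleton_add_two_le (hZ : IsGeometricSequence μ p Z)
    (hp₀ : 0 < p) (hp₁ : p < 1) {i : ℕ} (hi : 1 ≤ i) (n : ℕ) :
    μ.real (avoid Z {i} (n + 2)) ≤ (1 - letterProb p i ^ 2) * μ.real (avoid Z {i} n) := by
  have hS : ∀ j ∈ ({i} : Finset ℕ), 1 ≤ j := by simpa using hi
  have h1 := hZ.real_avoid_succ hS (n + 1)
  have h2 := hZ.real_avoid_succ hS n
  have h3 := hZ.real_avoid_last n (Finset.mem_singleton_self i) hi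
  have h4 : 0 ≤ μ.real (avoid Z {i} n ∩ {ω | Z n ω = i}) := measureReal_nonneg
  have h5 := letterProb_nonneg hp₀ hp₁ i
  have h6 : letterProb p i ≤ 1 := hZ.law 0 i hi ▸ measureReal_le_one
  rw [Finset.sum_singleton] at h1 h2
  rw [h1, h2, h3]
  nlinarith [mul_nonneg (mul_nonneg h4 h5) (sub_nonneg.2 h6)]

theorem IsGeometricSequence.real_avoid_singleton_le_pow (hZ : IsGeometricSequence μ p Z)
    (hp₀ : 0 < p) (hp₁ : p < 1) {i : ℕ} (hi : 1 ≤ i) (m : ℕ) :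
    μ.real (avoid Z {i} (2 * m)) ≤ (1 - letterProb p i ^ 2) ^ m := by
  have h5 := letterProb_nonneg hp₀ hp₁ i
  have h6 : letterProb p i ≤ 1 := hZ.law 0 i hi ▸ measureReal_le_one
  induction m with
  | zero => simp [avoid_zero]
  | succ m ih =>
    refine (hZ.real_avoid_singleton_add_two_le hp₀ hp₁ hi (2 * m)).trans ?_
    rw [pow_succ' (1 - letterProb p i ^ 2) m]
    exact mul_le_mul_of_nonneg_left ih (by nlinarith)

theorem IsGeometricSequence.real_avoid_singleton_le (hZ : IsGeometricSequence μ p Z)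
    (hp₀ : 0 < p) (hp₁ : p < 1) {i : ℕ} (hi : 1 ≤ i) {n : ℕ} (hn : 3 ≤ n) :
    μ.real (avoid Z {i} n) ≤ 4 * ((n + 1 : ℕ) * letterProb p i ^ 2)⁻¹ := by
  have hP : 0 < letterProb p i := mul_pos hp₀ (pow_pos (by linarith) _)
  have h6 : letterProb p i ≤ 1 := hZ.law 0 i hi ▸ measureReal_le_one
  have hsub : avoid Z {i} n ⊆ avoid Z {i} (2 * (n / 2)) := fun ω hω k hk => hω k (by omega)
  -- The two-step bound applies `n / 2` times, and the rounded-down half is still at least `(n + 1)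
  -- / 4` once `n ≥ 3`.
  have hm : ((n + 1 : ℕ) : ℝ) / 4 ≤ (n / 2 : ℕ) := by
    have : n + 1 ≤ 4 * (n / 2) := by omega
    have : ((n + 1 : ℕ) : ℝ) ≤ 4 * (n / 2 : ℕ) := by exact_mod_cast this
    linarith
  calc μ.real (avoid Z {i} n) ≤ μ.real (avoid Z {i} (2 * (n / 2))) := measureReal_mono hsub
    _ ≤ (1 - letterProb p i ^ 2) ^ (n / 2) := hZ.real_avoid_singleton_le_pow hp₀ hp₁ hi _
    _ ≤ Real.exp (-letterProb p i ^ 2) ^ (n / 2) := by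
        refine pow_le_pow_left₀ (by nlinarith) ?_ _
        linarith [Real.add_one_le_exp (-letterProb p i ^ 2)]
    _ = Real.exp (-((n / 2 : ℕ) * letterProb p i ^ 2)) := by
        rw [← Real.exp_nat_mul]; congr 1; ring
    _ ≤ Real.exp (-((n + 1 : ℕ) / 4 * letterProb p i ^ 2)) := by
        refine Real.exp_le_exp.2 (neg_le_neg ?_)
        gcongr
    _ ≤ ((n + 1 : ℕ) / 4 * letterProb p i ^ 2)⁻¹ := exp_neg_le_inv (by positivity)
    _ = 4 * ((n + 1 : ℕ) * letterProb p i ^ 2)⁻¹ := by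
        rw [div_mul_eq_mul_div, inv_div, div_eq_mul_inv]

theorem IsGeometricSequence.one_sub_real_avoid_singleton_le (hZ : IsGeometricSequence μ p Z)
    (hp₀ : 0 < p) (hp₁ : p < 1) {i : ℕ} (hi : 1 ≤ i) (n : ℕ) :
    1 - μ.real (avoid Z {i} n) ≤ n * letterProb p i ^ 2 := by
  induction n with
  | zero => simp [avoid_zero]
  | succ n ih =>
    rw [hZ.real_avoid_succ (by simpa using hi), Finset.sum_singleton]
    have h1 := mul_le_mul_of_nonneg_right (hZ.real_avoid_inter_le (S := {i}) n hi)
      (letterProb_nonneg hp₀ hp₁ i)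
    push_cast
    linarith

end String

end GeomPairs

/-! ### Inclusion-exclusion: from avoidance to patterns. -/

namespace GeomPairs

section Pattern

variable {ι Ω Ω' : Type*}

open Classical in
/-- The indices in `W` whose events occur at `ω`. -/
noncomputable def pattern (B : ι → Set Ω) (W : Finset ι) (ω : Ω) : Finset ι :=
  W.filter fun i => ω ∈ B i

theorem pattern_subset (B : ι → Set Ω) (W : Finset ι) (ω : Ω) : pattern B W ω ⊆ W := by
  classical exact Finset.filter_subset _ _

theorem pattern_eq_iff [DecidableEq ι] {B : ι → Set Ω} {W T : Finset ι} (hT : T ⊆ W) (ω : Ω) :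
    pattern B W ω = T ↔ ω ∈ (⋂ i ∈ T, B i) ∩ ⋂ i ∈ W \ T, (B i)ᶜ := by
  simp only [pattern, Set.mem_inter_iff, Set.mem_iInter, Set.mem_compl_iff, Finset.mem_sdiff]
  constructor
  · rintro rfl
    simp only [Finset.mem_filter]
    tauto
  · rintro ⟨h1, h2⟩
    ext i
    simp only [Finset.mem_filter]
    have := h1 i
    have := h2 i
    have := @hT i
    tauto

variable [MeasurableSpace Ω] [MeasurableSpace Ω']

theorem measurableSet_present_absent {B : ι → Set Ω} (hB : ∀ i, MeasurableSet (B i))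
    (T S : Finset ι) : MeasurableSet ((⋂ i ∈ T, B i) ∩ ⋂ i ∈ S, (B i)ᶜ) :=
  (T.measurableSet_biInter fun i _ => hB i).inter (S.measurableSet_biInter fun i _ => (hB i).compl)

variable [DecidableEq ι] {μ : Measure Ω} {ν : Measure Ω'} [IsFiniteMeasure μ] [IsFiniteMeasure ν]

theorem real_present_insert {B : ι → Set Ω} (hB : ∀ i, MeasurableSet (B i)) (T S : Finset ι)
    (t : ι) :
    μ.real ((⋂ i ∈ insert t T, B i) ∩ ⋂ i ∈ S, (B i)ᶜ) =
      μ.real ((⋂ i ∈ T, B i) ∩ ⋂ i ∈ S, (B i)ᶜ) -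
        μ.real ((⋂ i ∈ T, B i) ∩ ⋂ i ∈ insert t S, (B i)ᶜ) := by
  rw [← measureReal_sdiff ?_ (measurableSet_present_absent hB _ _)]
  · congr 1
    ext ω
    simp only [Finset.mem_insert, Set.mem_inter_iff, Set.mem_iInter, Set.mem_sdiff,
      Set.mem_compl_iff, forall_eq_or_imp]
    tauto
  · intro ω
    simp only [Finset.mem_insert, Set.mem_inter_iff, Set.mem_iInter, Set.mem_compl_iff,
      forall_eq_or_imp]
    tauto

/-- Inclusion-exclusion: closeness of the avoidance probabilities of two families of events
entails closeness of the probabilities of all patterns. -/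
theorem abs_real_present_absent_sub_le {B : ι → Set Ω} {C : ι → Set Ω'}
    (hB : ∀ i, MeasurableSet (B i)) (hC : ∀ i, MeasurableSet (C i)) {W : Finset ι} {ε : ℝ}
    (h : ∀ S ⊆ W, |μ.real (⋂ i ∈ S, (B i)ᶜ) - ν.real (⋂ i ∈ S, (C i)ᶜ)| ≤ ε) {T : Finset ι}
    (hT : T ⊆ W) : ∀ S ⊆ W, |μ.real ((⋂ i ∈ T, B i) ∩ ⋂ i ∈ S, (B i)ᶜ) -
      ν.real ((⋂ i ∈ T, C i) ∩ ⋂ i ∈ S, (C i)ᶜ)| ≤ 2 ^ T.card * ε := by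
  induction T using Finset.induction_on with
  | empty => simpa using h
  | insert t T ht ih =>
    intro S hS
    obtain ⟨htW, hTW⟩ := Finset.insert_subset_iff.1 hT
    have h1 := ih hTW S hS
    have h2 := ih hTW (insert t S) (Finset.insert_subset_iff.2 ⟨htW, hS⟩)
    rw [real_present_insert hB, real_present_insert hC, sub_sub_sub_comm,
      Finset.card_insert_of_notMem ht, pow_succ]
    refine (abs_sub _ _).trans ?_
    linarith

open Classical in
theorem real_pattern_mem {B : ι → Set Ω} (hB : ∀ i, MeasurableSet (B i)) (W : Finset ι)
    (𝒯 : Set (Finset ι)) :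
    μ.real {ω | pattern B W ω ∈ 𝒯} =
      ∑ T ∈ W.powerset.filter (· ∈ 𝒯), μ.real ((⋂ i ∈ T, B i) ∩ ⋂ i ∈ W \ T, (B i)ᶜ) := by
  rw [← measureReal_biUnion_finset]
  · congr 1
    ext ω
    simp only [Set.mem_ofPred_eq, Set.mem_iUnion, exists_prop, Finset.mem_filter,
      Finset.mem_powerset]
    constructor
    · intro h
      exact ⟨_, ⟨pattern_subset _ _ _, h⟩, (pattern_eq_iff (pattern_subset _ _ _) ω).1 rfl⟩
    · rintro ⟨T, ⟨hT, hT'⟩, h⟩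
      rwa [(pattern_eq_iff hT ω).2 h]
  · intro T hT T' hT' hne
    simp only [Finset.coe_filter, Finset.mem_powerset, Set.mem_ofPred_eq] at hT hT'
    refine Set.disjoint_left.2 fun ω h h' => hne ?_
    rw [← (pattern_eq_iff hT.1 ω).2 h, (pattern_eq_iff hT'.1 ω).2 h']
  · exact fun T _ => measurableSet_present_absent hB _ _

open Classical in
theorem abs_real_pattern_mem_sub_le {B : ι → Set Ω} {C : ι → Set Ω'}
    (hB : ∀ i, MeasurableSet (B i)) (hC : ∀ i, MeasurableSet (C i)) {W : Finset ι} {ε : ℝ}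
    (h : ∀ S ⊆ W, |μ.real (⋂ i ∈ S, (B i)ᶜ) - ν.real (⋂ i ∈ S, (C i)ᶜ)| ≤ ε)
    (𝒯 : Set (Finset ι)) :
    |μ.real {ω | pattern B W ω ∈ 𝒯} - ν.real {ω | pattern C W ω ∈ 𝒯}|
      ≤ 4 ^ W.card * ε := by
  have hε : 0 ≤ ε := (abs_nonneg _).trans (h ∅ (Finset.empty_subset _))
  rw [real_pattern_mem hB, real_pattern_mem hC, ← Finset.sum_sub_distrib]
  refine (Finset.abs_sum_le_sum_abs _ _).trans ?_
  -- At most `2 ^ |W|` patterns, each with error at most `2 ^ |W| * ε`.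
  calc _ ≤ ∑ T ∈ W.powerset.filter (· ∈ 𝒯), 2 ^ W.card * ε := by
        refine Finset.sum_le_sum fun T hT => ?_
        have hTW : T ⊆ W := Finset.mem_powerset.1 (Finset.mem_filter.1 hT).1
        refine (abs_real_present_absent_sub_le hB hC h hTW _ Finset.sdiff_subset).trans ?_
        gcongr
        norm_num
    _ ≤ ∑ T ∈ W.powerset, 2 ^ W.card * ε :=
        Finset.sum_le_sum_of_subset_of_nonneg (Finset.filter_subset _ _)
          fun _ _ _ => by positivity
    _ = 4 ^ W.card * ε := by
        rw [Finset.sum_const, Finset.card_powerset, nsmul_eq_mul, ← mul_assoc]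
        push_cast
        rw [← mul_pow]
        norm_num

end Pattern

/-! ### Reduction of both counts to a finite window. -/

theorem abs_real_sub_le_of_subset {Ω : Type*} [MeasurableSpace Ω] {μ : Measure Ω}
    [IsFiniteMeasure μ] {A A' D : Set Ω} (h : ∀ ω ∉ D, ω ∈ A ↔ ω ∈ A') :
    |μ.real A - μ.real A'| ≤ μ.real D := by
  have h1 : μ.real A ≤ μ.real A' + μ.real D :=
    (measureReal_mono fun ω hω => by
      by_cases hD : ω ∈ D
      · exact Or.inr hD
      · exact Or.inl ((h ω hD).1 hω)).trans (measureReal_union_le _ _)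
  have h2 : μ.real A' ≤ μ.real A + μ.real D :=
    (measureReal_mono fun ω hω => by
      by_cases hD : ω ∈ D
      · exact Or.inr hD
      · exact Or.inl ((h ω hD).2 hω)).trans (measureReal_union_le _ _)
  rw [abs_le]
  constructor <;> linarith

variable {p : ℝ}

theorem real_iUnion_le_tail {Ω : Type*} [MeasurableSpace Ω] {μ : Measure Ω} [IsFiniteMeasure μ]
    (hp₀ : 0 < p) (hp₁ : p < 1) {A : ℕ → Set Ω} {c t : ℝ} (hc : 0 ≤ c)
    (h : ∀ k : ℕ, μ.real (A k) ≤ c * Real.exp (-2 * L p * (t + k))) :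
    μ.real (⋃ k, A k) ≤ c * (Real.exp (-2 * L p * t) * (1 - (1 - p) ^ 2)⁻¹) := by
  have hs := (hasSum_exp_tail hp₀ hp₁ t).mul_left c
  have hnn : ∀ k : ℕ, 0 ≤ c * Real.exp (-2 * L p * (t + k)) := fun k => by positivity
  rw [← hs.tsum_eq]
  refine ENNReal.toReal_le_of_le_ofReal (tsum_nonneg hnn) ?_
  rw [ENNReal.ofReal_tsum_of_nonneg hnn hs.summable]
  refine (measure_iUnion_le _).trans (ENNReal.tsum_le_tsum fun k => ?_)
  rw [← ofReal_measureReal]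
  exact ENNReal.ofReal_le_ofReal (h k)

/-- This identity is what `i*` is designed for: the Poisson parameters become a fixed geometric
profile translated by `i*`. -/
theorem mul_letterProb_sq (hp₀ : 0 < p) (hp₁ : p < 1) {n i : ℕ} (hn : 1 ≤ n) (hi : 1 ≤ i) :
    n * letterProb p i ^ 2 = Real.exp (-2 * L p * (i - iStar p n)) := by
  have hq : 0 < 1 - p := by linarith
  have hn' : (0 : ℝ) < n := by exact_mod_cast hn
  have hL := L_pos hp₀ hp₁
  have h := exp_shift hp₁ (-iStar p n) i
  rw [neg_add_eq_sub] at h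
  have hx : -2 * L p * -iStar p n = Real.log (n * p ^ 2 / (1 - p) ^ 2) := by
    rw [iStar]; field_simp
  rw [h, hx, Real.exp_log (by positivity), letterProb]
  obtain ⟨j, rfl⟩ := Nat.exists_eq_add_of_le' hi
  rw [Nat.add_sub_cancel]
  generalize 1 - p = q at hq ⊢
  field_simp
  ring

section Count

open Classical in
theorem pairIndicator_eq {Ω : Type*} (Z : ℕ → Ω → ℕ) (n i : ℕ) (ω : Ω) :
    pairIndicator Z n i i ω = if ω ∈ (avoid Z {i} (n - 1))ᶜ then 1 else 0 := by
  unfold pairIndicator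
  congr 1
  simp only [avoid, Set.mem_compl_iff, Set.mem_ofPred_eq, Finset.mem_singleton, eq_iff_iff]
  push Not
  constructor
  · rintro ⟨k, h1, h2, h3⟩
    exact ⟨k, by omega, by rw [h2, h3], h2⟩
  · rintro ⟨k, h1, h2, h3⟩
    exact ⟨k, by omega, h3, by rw [← h2, h3]⟩

open Classical in
theorem X₁_eq {Ω : Type*} (Z : ℕ → Ω → ℕ) (n : ℕ) (ω : Ω) {lo hi : ℕ} (hlh : lo ≤ hi)
    (hlo : ∀ i, 1 ≤ i → i ≤ lo → ω ∉ avoid Z {i} (n - 1))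
    (hhi : ∀ i, hi < i → ω ∈ avoid Z {i} (n - 1)) :
    X₁ Z n ω = lo + (pattern (fun i => (avoid Z {i} (n - 1))ᶜ) (Finset.Ioc lo hi) ω).card := by
  have h1 : X₁ Z n ω = ∑ i ∈ Finset.Ioc 0 hi, pairIndicator Z n i i ω := by
    rw [X₁, tsum_pnat_eq_tsum_succ (f := fun i => pairIndicator Z n i i ω),
      tsum_eq_sum (s := Finset.range hi), Finset.range_eq_Ico,
      Finset.sum_Ico_add' (fun i => pairIndicator Z n i i ω)]
    · exact Finset.sum_congr (by ext; simp only [Finset.mem_Ico, Finset.mem_Ioc]; omega)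
        fun _ _ => rfl
    · intro i hi'
      rw [pairIndicator_eq, if_neg]
      simpa using hhi (i + 1) (by simp at hi'; omega)
  rw [h1, ← Finset.sum_Ioc_consecutive _ (Nat.zero_le lo) hlh]
  simp_rw [pairIndicator_eq]
  rw [Finset.sum_boole, Finset.sum_boole, Finset.filter_true_of_mem]
  · simp [pattern]
  · intro i hi'
    rw [Finset.mem_Ioc] at hi'
    exact hlo i (by omega) hi'.2

open Classical in
theorem total_eq_of_window {ω : ℤ → Bool} {lo hi : ℕ}
    (hlo : ∀ k : ℕ, ω (lo - k) = true) (hhi : ∀ k : ℕ, ω (hi + 1 + k) = false) :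
    total ω = lo + (pattern (fun i : ℕ => {ω : ℤ → Bool | ω i = true}) (Finset.Ioc lo hi) ω).card := by
  have hset : {i : ℤ | (lo : ℤ) < i ∧ ω i = true} =
      ((pattern (fun i : ℕ => {ω : ℤ → Bool | ω i = true}) (Finset.Ioc lo hi) ω).map
        Nat.castEmbedding : Finset ℤ) := by
    ext i
    simp only [pattern, Set.mem_ofPred_eq, Finset.coe_map, Nat.castEmbedding_apply, Finset.coe_filter,
      Finset.mem_Ioc, Set.mem_image]
    constructor
    · rintro ⟨h1, h2⟩
      refine ⟨i.toNat, ⟨⟨by omega, ?_⟩, ?_⟩, by omega⟩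
      · by_contra hlt
        have := hhi (i - (hi + 1)).toNat
        rw [show (hi : ℤ) + 1 + ((i - (hi + 1)).toNat : ℤ) = i by omega, h2] at this
        exact absurd this (by simp)
      · rwa [Int.toNat_of_nonneg (by omega)]
    · rintro ⟨j, ⟨⟨h1, h2⟩, h3⟩, rfl⟩
      exact ⟨by omega, h3⟩
  have hlev : HasLevel ω lo := by
    refine ⟨fun i hi => ?_, ?_⟩
    · have := hlo (lo - i).toNat
      rwa [Int.toNat_of_nonneg (by omega), sub_sub_cancel] at this
    · rw [hset]
      exact Finset.finite_toSet _
  rw [hlev.total_eq, hset, Set.ncard_coe_finset, Finset.card_map]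

end Count

end GeomPairs

/-! ### Comparison of the string with the model. -/

namespace GeomPairs

theorem compl_avoid_singleton_inter {Ω : Type*} (Z : ℕ → Ω → ℕ) (S : Finset ℕ) (n : ℕ) :
    ⋂ i ∈ S, ((avoid Z {i} n)ᶜ)ᶜ = avoid Z S n := by
  ext ω
  simp only [avoid, compl_compl, Set.mem_iInter, Set.mem_ofPred_eq, Finset.mem_singleton]
  exact ⟨fun h k hk heq hm => h _ hm k hk heq rfl, fun h i hi k hk heq hm => h k hk heq (hm ▸ hi)⟩

variable {Ω : Type*} [MeasurableSpace Ω] {μ : Measure Ω} {p : ℝ} {Z : ℕ → Ω → ℕ}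

theorem model_real_all_false (p y : ℝ) (S : Finset ℕ) :
    (model p y).real (⋂ i ∈ S, {ω : ℤ → Bool | ω i = true}ᶜ) =
      Real.exp (-∑ i ∈ S, Real.exp (-2 * L p * (i + y))) := by
  have h : (⋂ i ∈ S, {ω : ℤ → Bool | ω i = true}ᶜ) =
      {ω | ∀ i ∈ S.map Nat.castEmbedding, ω i = false} := by
    ext ω; simp
  rw [h, model_real_cylinder p y _ fun _ => false, Finset.prod_map, ← Finset.sum_neg_distrib,
    Real.exp_sum]
  simp [coinMass, dexp, add_comm]

variable [IsProbabilityMeasure μ]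

theorem IsGeometricSequence.real_low_missing_le (hZ : IsGeometricSequence μ p Z)
    (hp₀ : 0 < p) (hp₁ : p < 1) {n : ℕ} (hn : 4 ≤ n) (lo : ℕ) :
    μ.real (⋃ k : ℕ, {ω | k < lo ∧ ω ∈ avoid Z {lo - k} (n - 1)}) ≤
      4 * (Real.exp (-2 * L p * (iStar p n - lo)) * (1 - (1 - p) ^ 2)⁻¹) := by
  refine real_iUnion_le_tail hp₀ hp₁ (by norm_num) fun k => ?_
  by_cases hk : k < lo
  · simp only [hk, true_and]
    have h := hZ.real_avoid_singleton_le hp₀ hp₁ (show 1 ≤ lo - k by omega)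
      (show 3 ≤ n - 1 by omega)
    rw [Nat.sub_add_cancel (by omega), mul_letterProb_sq hp₀ hp₁ (by omega) (by omega),
      ← Real.exp_neg, Nat.cast_sub hk.le] at h
    refine h.trans_eq ?_
    congr 2; ring
  · simp only [hk, false_and]
    simp only [Set.ofPred_false, measureReal_empty]
    positivity

theorem IsGeometricSequence.real_high_present_le (hZ : IsGeometricSequence μ p Z)
    (hp₀ : 0 < p) (hp₁ : p < 1) {n : ℕ} (hn : 1 ≤ n) (hi : ℕ) :
    μ.real (⋃ k : ℕ, (avoid Z {hi + 1 + k} (n - 1))ᶜ) ≤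
      1 * (Real.exp (-2 * L p * (hi + 1 - iStar p n)) * (1 - (1 - p) ^ 2)⁻¹) := by
  refine real_iUnion_le_tail hp₀ hp₁ zero_le_one fun k => ?_
  rw [probReal_compl_eq_one_sub (hZ.measurableSet_avoid _ _)]
  refine (hZ.one_sub_real_avoid_singleton_le hp₀ hp₁ (by omega) _).trans ?_
  calc ((n - 1 : ℕ) : ℝ) * letterProb p (hi + 1 + k) ^ 2
      ≤ n * letterProb p (hi + 1 + k) ^ 2 := by
        gcongr
        omega
    _ = _ := by
        rw [mul_letterProb_sq hp₀ hp₁ hn (by omega), one_mul]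
        push_cast
        congr 2; ring

theorem model_real_low_false_le (hp₀ : 0 < p) (hp₁ : p < 1) (y : ℝ) (lo : ℤ) :
    (model p y).real (⋃ k : ℕ, {ω | ω (lo - k) = false}) ≤
      1 * (Real.exp (-2 * L p * (-y - lo)) * (1 - (1 - p) ^ 2)⁻¹) := by
  refine real_iUnion_le_tail hp₀ hp₁ zero_le_one fun k => ?_
  rw [model_real_bit, one_mul]
  refine (dexp_le p _).trans_eq ?_
  push_cast
  congr 2; ring

theorem model_real_high_true_le (hp₀ : 0 < p) (hp₁ : p < 1) (y : ℝ) (hi : ℤ) :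
    (model p y).real (⋃ k : ℕ, {ω | ω (hi + 1 + k) = true}) ≤
      1 * (Real.exp (-2 * L p * (hi + 1 + y)) * (1 - (1 - p) ^ 2)⁻¹) := by
  refine real_iUnion_le_tail hp₀ hp₁ zero_le_one fun k => ?_
  rw [model_real_bit, one_mul]
  refine (one_sub_dexp_le p _).trans_eq ?_
  push_cast
  congr 2; ring

/-- Off the exceptional events, both counts equal `lo` plus the size of the window pattern. The
constant `5` adds the lower tails of string (`4`) and model (`1`), and `2` adds the two upper tails;
the last term is the pattern comparison. -/
theorem IsGeometricSequence.abs_real_sub_model_le (hZ : IsGeometricSequence μ p Z)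
    (hp₀ : 0 < p) (hp₁ : p < 1) {n : ℕ} (hn : 4 ≤ n) {lo hi : ℕ} (hlh : lo ≤ hi) {δ : ℝ}
    (hδ1 : δ ≤ 1) (hδ : ∀ i ∈ Finset.Ioc lo hi, letterProb p i ≤ δ)
    (hs : ∑ i ∈ Finset.Ioc lo hi, letterProb p i ^ 2 ≤ δ) (E : Set ℤ) :
    |μ.real {ω | (X₁ Z n ω : ℤ) ∈ E} - (model p (-iStar p n)).real {ω | total ω ∈ E}| ≤
      5 * (Real.exp (-2 * L p * (iStar p n - lo)) * (1 - (1 - p) ^ 2)⁻¹) +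
      2 * (Real.exp (-2 * L p * (hi + 1 - iStar p n)) * (1 - (1 - p) ^ 2)⁻¹) +
      4 ^ (hi - lo) * (2 * (n * ∑ i ∈ Finset.Ioc lo hi, letterProb p i ^ 2) * δ + δ) := by
  set x := iStar p n with hxdef
  set W := Finset.Ioc lo hi with hW
  have hδ0 : 0 ≤ δ := (Finset.sum_nonneg fun i _ => sq_nonneg _).trans hs
  let B : ℕ → Set Ω := fun i => (avoid Z {i} (n - 1))ᶜ
  let C : ℕ → Set (ℤ → Bool) := fun i => {ω | ω i = true}
  let 𝒯 : Set (Finset ℕ) := {T | (lo : ℤ) + T.card ∈ E}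
  have hpat := abs_real_pattern_mem_sub_le (μ := μ) (ν := model p (-x)) (B := B) (C := C) (W := W)
    (ε := 2 * (n * ∑ i ∈ W, letterProb p i ^ 2) * δ + δ)
    (fun i => (hZ.measurableSet_avoid _ _).compl) (fun i => measurableSet_bit _ _) (by
      intro S hS
      have hS1 : ∀ i ∈ S, 1 ≤ i := fun i hi => by
        have := Finset.mem_Ioc.1 (hS hi); omega
      have hsum : ∑ i ∈ S, letterProb p i ^ 2 ≤ ∑ i ∈ W, letterProb p i ^ 2 :=
        Finset.sum_le_sum_of_subset_of_nonneg hS fun _ _ _ => sq_nonneg _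
      have h := hZ.abs_real_avoid_sub_le hp₀ hp₁ hS1 hδ1 (fun i hi => hδ i (hS hi))
        (hsum.trans hs) (n - 1)
      rw [Nat.sub_add_cancel (by omega)] at h
      rw [compl_avoid_singleton_inter, model_real_all_false]
      have he : ∑ i ∈ S, Real.exp (-2 * L p * (i + -x)) = n * ∑ i ∈ S, letterProb p i ^ 2 := by
        rw [Finset.mul_sum]
        refine Finset.sum_congr rfl fun i hi => ?_
        rw [mul_letterProb_sq hp₀ hp₁ (by omega) (hS1 i hi), ← sub_eq_add_neg]
      rw [he]
      refine h.trans ?_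
      gcongr) 𝒯
  have hX := abs_real_sub_le_of_subset (μ := μ) (A := {ω | (X₁ Z n ω : ℤ) ∈ E})
    (A' := {ω | pattern B W ω ∈ 𝒯})
    (D := (⋃ k : ℕ, {ω | k < lo ∧ ω ∈ avoid Z {lo - k} (n - 1)}) ∪
      ⋃ k : ℕ, (avoid Z {hi + 1 + k} (n - 1))ᶜ) (by
      intro ω hω
      simp only [Set.mem_union, Set.mem_iUnion, Set.mem_ofPred_eq, Set.mem_compl_iff, not_or,
        not_exists, not_not, not_and] at hω
      rw [Set.mem_ofPred_eq, X₁_eq Z n ω hlh]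
      · simp [𝒯, B, W]
      · intro i h1 h2
        have := hω.1 (lo - i) (by omega)
        rwa [Nat.sub_sub_self h2] at this
      · intro i h
        have := hω.2 (i - (hi + 1))
        rwa [Nat.add_sub_cancel' (by omega)] at this)
  have hT := abs_real_sub_le_of_subset (μ := model p (-x)) (A := {ω | total ω ∈ E})
    (A' := {ω | pattern C W ω ∈ 𝒯})
    (D := (⋃ k : ℕ, {ω | ω ((lo : ℤ) - k) = false}) ∪
      ⋃ k : ℕ, {ω | ω ((hi : ℤ) + 1 + k) = true}) (by
      intro ω hω
      simp only [Set.mem_union, Set.mem_iUnion, Set.mem_ofPred_eq, not_or,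
        not_exists, Bool.not_eq_true, Bool.not_eq_false] at hω
      rw [Set.mem_ofPred_eq, total_eq_of_window hω.1 hω.2]
      rfl)
  have h1 := hX.trans ((measureReal_union_le _ _).trans (add_le_add
    (hZ.real_low_missing_le hp₀ hp₁ hn lo) (hZ.real_high_present_le hp₀ hp₁ (by omega) hi)))
  have h2 := hT.trans ((measureReal_union_le _ _).trans (add_le_add
    (model_real_low_false_le hp₀ hp₁ (-x) lo) (model_real_high_true_le hp₀ hp₁ (-x) hi)))
  rw [hW, Nat.card_Ioc, ← hW] at hpat
  push_cast at h2
  rw [neg_neg, ← sub_eq_add_neg] at h2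
  rw [← hxdef] at h1
  rw [abs_le] at h1 h2 hpat ⊢
  constructor <;> linarith

theorem tendsto_iStar (hp₀ : 0 < p) (hp₁ : p < 1) : Tendsto (iStar p) atTop atTop := by
  have hq : 0 < 1 - p := by linarith
  have hL := L_pos hp₀ hp₁
  refine Tendsto.atTop_div_const (by positivity) (Real.tendsto_log_atTop.comp ?_)
  exact (tendsto_natCast_atTop_atTop.atTop_mul_const (by positivity)).atTop_div_const (by positivity)

theorem tendsto_exp_tail (hp₀ : 0 < p) (hp₁ : p < 1) :
    Tendsto (fun K : ℕ => Real.exp (-2 * L p * K)) atTop (𝓝 0) := by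
  simpa using (hasSum_exp_tail hp₀ hp₁ 0).summable.tendsto_atTop_zero

/-- The number of types of identical pairs is uniformly close in law to the renormalised number
of `true` bits in the model. -/
theorem IsGeometricSequence.eventually_abs_real_sub_model_lt (hZ : IsGeometricSequence μ p Z)
    (hp₀ : 0 < p) (hp₁ : p < 1) {ε : ℝ} (hε : 0 < ε) :
    ∀ᶠ n : ℕ in atTop, ∀ E : Set ℤ,
      |μ.real {ω | (X₁ Z n ω : ℤ) ∈ E} - (model p (-iStar p n)).real {ω | total ω ∈ E}| < ε := by
  have hL := L_pos hp₀ hp₁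
  set G := (1 - (1 - p) ^ 2)⁻¹ with hG
  have hG0 : 0 < G := inv_pos.2 (by linarith [ratio_lt_one hp₀ hp₁])
  -- The `7` is `5 + 2`, the total weight of the tails outside a window of half-width `K`.
  obtain ⟨K, hK⟩ : ∃ K : ℕ, 7 * (Real.exp (-2 * L p * K) * G) < ε / 2 := by
    have h := ((tendsto_exp_tail hp₀ hp₁).mul_const G).const_mul 7
    rw [zero_mul, mul_zero] at h
    exact (h.eventually_lt_const (half_pos hε)).exists
  -- Window letters satisfy `i* - i ≤ K + 1`, so `n P_i² ≤ c`; there are `2 * K` of them, so `s`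
  -- bounds the total Poisson parameter independently of `n`.
  set c := Real.exp (2 * L p * (K + 1)) with hc
  set s := 2 * K * c with hsdef
  have hc0 : 0 < c := Real.exp_pos _
  have hs0 : 0 ≤ s := by positivity
  obtain ⟨δ, hδ0, hδ1, hδ⟩ : ∃ δ : ℝ, 0 < δ ∧ δ ≤ 1 ∧ 4 ^ (2 * K) * (2 * s * δ + δ) ≤ ε / 2 := by
    have hA : (0 : ℝ) < 4 ^ (2 * K) * (2 * s + 1) := by positivity
    refine ⟨min 1 (ε / 2 / (4 ^ (2 * K) * (2 * s + 1))), by positivity, min_le_left _ _, ?_⟩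
    have h := (le_div_iff₀ hA).1 (min_le_right 1 (ε / 2 / (4 ^ (2 * K) * (2 * s + 1))))
    linarith
  -- With `K` and `δ` fixed, `n ≥ c / δ²` makes the window letter probabilities at most `δ`, and `n
  -- ≥ s / δ` does the same for the sum of their squares.
  filter_upwards [eventually_ge_atTop 4, (tendsto_iStar hp₀ hp₁).eventually_ge_atTop (K : ℝ),
    tendsto_natCast_atTop_atTop.eventually_ge_atTop (c / δ ^ 2),
    tendsto_natCast_atTop_atTop.eventually_ge_atTop (s / δ)] with n hn hx hn1 hn2 E
  have hn0 : (0 : ℝ) < n := by exact_mod_cast (by omega : 0 < n)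
  set x := iStar p n with hxdef
  have hx0 : 0 ≤ x := (Nat.cast_nonneg K).trans hx
  have hKx : K ≤ ⌊x⌋₊ := Nat.le_floor hx
  have hf1 := Nat.floor_le hx0
  have hf2 := Nat.lt_floor_add_one x
  have hlo : ((⌊x⌋₊ - K : ℕ) : ℝ) = ⌊x⌋₊ - K := Nat.cast_sub hKx
  have hlet : ∀ i ∈ Finset.Ioc (⌊x⌋₊ - K) (⌊x⌋₊ + K), letterProb p i ^ 2 ≤ c / n := by
    intro i hi
    rw [Finset.mem_Ioc] at hi
    rw [le_div_iff₀' hn0, mul_letterProb_sq hp₀ hp₁ (by omega) (by omega), hc]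
    refine Real.exp_le_exp.2 ?_
    have h1 : ((⌊x⌋₊ - K : ℕ) : ℝ) ≤ i := by exact_mod_cast hi.1.le
    have h2 : x - i ≤ K + 1 := by linarith
    nlinarith
  have hcard : (Finset.Ioc (⌊x⌋₊ - K) (⌊x⌋₊ + K)).card = 2 * K := by
    rw [Nat.card_Ioc]; omega
  have hsum : ∑ i ∈ Finset.Ioc (⌊x⌋₊ - K) (⌊x⌋₊ + K), letterProb p i ^ 2 ≤ s / n := by
    refine (Finset.sum_le_card_nsmul _ _ _ hlet).trans_eq ?_
    rw [hcard, nsmul_eq_mul, hsdef]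
    push_cast
    ring
  have hmain := hZ.abs_real_sub_model_le hp₀ hp₁ hn (show ⌊x⌋₊ - K ≤ ⌊x⌋₊ + K by omega) hδ1
    (fun i hi => by
      refine le_of_sq_le_sq ((hlet i hi).trans ?_) hδ0.le
      rw [div_le_iff₀ hn0]
      rwa [div_le_iff₀' (by positivity)] at hn1)
    (hsum.trans (by
      rw [div_le_iff₀ hn0]
      rwa [div_le_iff₀' hδ0] at hn2)) E
  refine hmain.trans_lt ?_
  have e1 : Real.exp (-2 * L p * (x - (⌊x⌋₊ - K : ℕ))) ≤ Real.exp (-2 * L p * K) := by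
    refine Real.exp_le_exp.2 ?_
    rw [hlo]
    nlinarith
  have e2 : Real.exp (-2 * L p * ((⌊x⌋₊ + K : ℕ) + 1 - x)) ≤ Real.exp (-2 * L p * K) := by
    refine Real.exp_le_exp.2 ?_
    push_cast
    nlinarith
  have e3 := mul_le_mul_of_nonneg_right e1 hG0.le
  have e4 := mul_le_mul_of_nonneg_right e2 hG0.le
  have e5 : n * ∑ i ∈ Finset.Ioc (⌊x⌋₊ - K) (⌊x⌋₊ + K), letterProb p i ^ 2 ≤ s := by
    rwa [le_div_iff₀' hn0] at hsum
  have e6 : (4 : ℝ) ^ (⌊x⌋₊ + K - (⌊x⌋₊ - K)) *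
      (2 * (n * ∑ i ∈ Finset.Ioc (⌊x⌋₊ - K) (⌊x⌋₊ + K), letterProb p i ^ 2) * δ + δ) ≤ ε / 2 := by
    refine le_trans ?_ hδ
    rw [show ⌊x⌋₊ + K - (⌊x⌋₊ - K) = 2 * K by omega]
    gcongr
  linarith

/-- A vanishing absolute error is a vanishing relative error when the comparison sequence stays away
from `0`. -/
theorem isEquivalent_of_lower_bound {u v : ℕ → ℝ} {c : ℝ} (hc : 0 < c) (hv : ∀ n, c ≤ v n)
    (h : ∀ ε : ℝ, 0 < ε → ∀ᶠ n in atTop, |u n - v n| < ε) : u ~[atTop] v := by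
  refine isLittleO_iff.2 fun a ha => ?_
  filter_upwards [h (a * c) (by positivity)] with n hn
  rw [Pi.sub_apply, Real.norm_eq_abs, Real.norm_eq_abs]
  refine hn.le.trans (mul_le_mul_of_nonneg_left ((hv n).trans (le_abs_self _)) ha.le)

end GeomPairs

/-- Both probabilities in the hypothesis `hconj` tend to `0` for fixed `t`, so `hconj` carries no
information at the scale `i*`. The comparison of `X₁` with independent Poisson indicators on that
scale is therefore proved directly, and `ξ` and `hconj` are not used. -/
theorem mainTheorem6 {Ω Ω' : Type*} [MeasurableSpace Ω] [MeasurableSpace Ω']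
    (μ : Measure Ω) [IsProbabilityMeasure μ] (ν : Measure Ω') [IsProbabilityMeasure ν]
    (p : ℝ) (hp₀ : 0 < p) (hp₁ : p < 1)
    (Z : ℕ → Ω → ℕ) (hZ : GeomPairs.IsGeometricSequence μ p Z)
    (ξ : ℕ → ℕ+ → Ω' → ℕ) (hξ : GeomPairs.IsPoissonModel ν p ξ)
    (hconj : GeomPairs.DistributionsMerge μ ν Z ξ) :
    -- all infinite products and sums in the definitions of `Ψ`, `f` and `F` converge
    (∀ η : ℝ,
      Multipliable (fun i : ℕ+ => 1 - GeomPairs.dexp p (η - (i : ℕ))) ∧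
      (∀ v : ℕ, Summable (GeomPairs.tupleWeight p η v)) ∧
      Summable (GeomPairs.fTerm p η) ∧
      Summable (fun i : ℕ => GeomPairs.f p (η - i))) ∧
    -- with `η = i - i*`, uniformly in the integer `i`, the differences tend to `0`
    (∀ ε : ℝ, 0 < ε → ∀ᶠ n : ℕ in atTop, ∀ i : ℤ,
      |μ.real {ω | (GeomPairs.X₁ Z n ω : ℤ) = i} -
        GeomPairs.f p (i - GeomPairs.iStar p n)| < ε ∧
      |μ.real {ω | (GeomPairs.X₁ Z n ω : ℤ) ≤ i} -
        GeomPairs.F p (i - GeomPairs.iStar p n)| < ε) ∧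
    -- as long as `η = i - i*` stays bounded, the quotients tend to `1`
    (∀ i : ℕ → ℤ, (∃ M : ℝ, ∀ n, |(i n : ℝ) - GeomPairs.iStar p n| ≤ M) →
      (fun n : ℕ => μ.real {ω | (GeomPairs.X₁ Z n ω : ℤ) = i n}) ~[atTop]
        (fun n : ℕ => GeomPairs.f p (i n - GeomPairs.iStar p n)) ∧
      (fun n : ℕ => μ.real {ω | (GeomPairs.X₁ Z n ω : ℤ) ≤ i n}) ~[atTop]
        (fun n : ℕ => GeomPairs.F p (i n - GeomPairs.iStar p n))) := by
  have hdiff : ∀ ε : ℝ, 0 < ε → ∀ᶠ n : ℕ in atTop, ∀ i : ℤ,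
      |μ.real {ω | (GeomPairs.X₁ Z n ω : ℤ) = i} -
        GeomPairs.f p (i - GeomPairs.iStar p n)| < ε ∧
      |μ.real {ω | (GeomPairs.X₁ Z n ω : ℤ) ≤ i} -
        GeomPairs.F p (i - GeomPairs.iStar p n)| < ε := by
    intro ε hε
    filter_upwards [hZ.eventually_abs_real_sub_model_lt hp₀ hp₁ hε] with n hn i
    rw [sub_eq_neg_add (i : ℝ), GeomPairs.f_add_eq hp₀ hp₁, GeomPairs.F_add_eq hp₀ hp₁]
    -- Uniformity over all sets of integers gives point probabilities and distribution functions at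
    -- once, uniformly in `i`.
    exact ⟨hn {i}, hn (Set.Iic i)⟩
  refine ⟨fun η => ⟨GeomPairs.multipliable_one_sub_dexp hp₀ hp₁ η,
    GeomPairs.summable_tupleWeight hp₀ hp₁ η, GeomPairs.summable_fTerm hp₀ hp₁ η, ?_⟩, hdiff, ?_⟩
  · simpa using (GeomPairs.hasSum_f_sub hp₀ hp₁ η 0).summable
  · rintro i ⟨M, hM⟩
    obtain ⟨c, hc, hf⟩ := GeomPairs.exists_pos_le_f hp₀ hp₁ M
    constructor
    · refine GeomPairs.isEquivalent_of_lower_bound hc (fun n => hf _ (hM n)) fun ε hε => ?_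
      filter_upwards [hdiff ε hε] with n hn
      exact (hn (i n)).1
    · refine GeomPairs.isEquivalent_of_lower_bound hc
        (fun n => (hf _ (hM n)).trans (GeomPairs.f_le_F hp₀ hp₁ _)) fun ε hε => ?_
      filter_upwards [hdiff ε hε] with n hn
      exact (hn (i n)).2
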